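/- Let $n$ be a positive integer, and put $$J_{2n}=\begin{bmatrix}0&-I_n\\ I_n&0\end{bmatrix},\qquad I_{n,n}=\begin{bmatrix}I_n&0\\0&-I_n\end{bmatrix},\qquad X^{\mathsf L}=I_{n,n}X^{\mathsf H}I_{n,n}\quad(X\in\mathbb{C}^{2n\times 2n}),$$ where $X^{\mathsf H}$ is the conjugate transpose. Let $\mathrm{Sp}(n)=\mathrm{U}(2n)\cap \mathrm{Sp}(2n,\mathbb{C})$ be the compact symplectic group, where $\mathrm{Sp}(2n,\mathbb{C})=\{Q\in\mathbb{C}^{2n\times 2n}: Q^{\mathsf T}J_{2n}Q=J_{2n}\}$, with its smooth structure as an embedded submanifold of $\mathbb{C}^{2n\times 2n}$. Regard $\mathrm{U}(n)$ as the subgroup $\{\operatorname{diag}(A,\overline{A}):A\in \mathrm{U}(n)\}$ of $\mathrm{Sp}(n)$, and give $\mathrm{Sp}(n)/\mathrm{U}(n)$ the quotient topology and the smooth structure for which the projection $\mathrm{Sp}(n)\to\mathrm{Sp}(n)/\mathrm{U}(n)$, $Q\mapsto[Q]$, is a smooth submersion. Let $\mathrm{LGr}(\mathbb{C}^{2n})$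 be the set of Lagrangian complex subspaces of $\mathbb{C}^{2n}$ with respect to the complex symplectic form $\omega(v,w)=v^{\mathsf T}J_{2n}w$, with its standard structure of a real smooth manifold, for which all the maps $S\mapsto A\{(x,Sx):x\in\mathbb{C}^n\}$, $A\in\mathrm{Sp}(2n,\mathbb{C})$, from the space of complex symmetric $n\times n$ matrices to $\mathrm{LGr}(\mathbb{C}^{2n})$ are local diffeomorphisms. Let $\mathsf{V}^2(\mathbb{C}^{2n})=\{X\in\mathbb{C}^{2n\times 2n}:X=X^{\mathsf L}\}$. Then these smooth structures exist, $\{QQ^{\mathsf L}:Q\in\mathrm{Sp}(n)\}$ is an embedded smooth submanifold of $\mathbb{C}^{2n\times 2n}$, and there are $\mathrm{Sp}(n)$-equivariant diffeomorphisms of real manifolds of dimension $n(n+1)$ $$\mathrm{LGr}(\mathbb{C}^{2n})\;\cong\;\mathrm{Sp}(n)/\mathrm{U}(n)\;\cong\;\{QQ^{\mathsf L}:Q\in \mathrm{Sp}(n)\},$$ the first given by $Q(\mathbb{C}^n\times\{0\})\mapsto[Q]$ and the second by $[Q]\mapsto QQ^{\mathsf L}$; here $A\in\mathrm{Sp}(n)$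 acts on the three spaces by $L\mapsto AL$, $[Q]\mapsto[AQ]$ and $X\mapsto AXA^{\mathsf L}$, respectively. Moreover, $$\{QQ^{\mathsf L}:Q\in \mathrm{Sp}(n)\}=\mathrm{Sp}(n)\cap\mathsf{V}^2(\mathbb{C}^{2n})=\{X\in\mathrm{Sp}(n):X=X^{\mathsf L}\}.$$ -/

import Mathlib

open scoped ContDiff Manifold Matrix

noncomputable section

namespace ComplexLagrangian

/-- Complex `2n × 2n` matrices, written in `n × n` blocks. -/
abbrev BlockMat (n : ℕ) : Type := Matrix (Fin n ⊕ Fin n) (Fin n ⊕ Fin n) ℂ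

/-- The compact symplectic group `Sp(n) = U(2n) ∩ Sp(2n, ℂ)`. -/
def Sp (n : ℕ) : Submonoid (BlockMat n) :=
  Matrix.unitaryGroup (Fin n ⊕ Fin n) ℂ ⊓ Matrix.symplecticGroup (Fin n) ℂ

theorem conjTranspose_mem_Sp {n : ℕ} {Q : BlockMat n} (hQ : Q ∈ Sp n) : Qᴴ ∈ Sp n := by
  refine ⟨Unitary.star_mem hQ.1, ?_⟩
  have h1 : Q⁻¹ = Qᴴ := Matrix.inv_eq_left_inv (Matrix.mem_unitaryGroup_iff'.1 hQ.1)
  have h2 := ((⟨Q, hQ.2⟩ : Matrix.symplecticGroup (Fin n) ℂ)⁻¹).2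
  rwa [SymplecticGroup.coe_inv', h1] at h2

instance (n : ℕ) : Group (Sp n) :=
  { (inferInstance : Monoid (Sp n)) with
    inv := fun Q => ⟨(Q : BlockMat n)ᴴ, conjTranspose_mem_Sp Q.2⟩
    inv_mul_cancel := fun Q => Subtype.ext (Matrix.mem_unitaryGroup_iff'.1 Q.2.1) }

/-- The space of `2n × 2n` arrays of complex numbers, a normed space with the usual topology. -/
abbrev Entries (n : ℕ) : Type := Fin n ⊕ Fin n → Fin n ⊕ Fin n → ℂ

/-- The entries of a matrix. -/
def entries {n : ℕ} (X : BlockMat n) : Entries n := Matrix.of.symm X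

/-- An element of `Sp(n)` as an element of `Sp(2n, ℂ)`. -/
def toSymplectic {n : ℕ} (Q : Sp n) : Matrix.symplecticGroup (Fin n) ℂ := ⟨Q, Q.2.2⟩

theorem fromBlocks_mem_Sp {n : ℕ} (A : Matrix.unitaryGroup (Fin n) ℂ) :
    (Matrix.fromBlocks (A : Matrix (Fin n) (Fin n) ℂ) 0 0
      ((A : Matrix (Fin n) (Fin n) ℂ).map star) : BlockMat n) ∈ Sp n := by
  have h1 : (A : Matrix (Fin n) (Fin n) ℂ) * (A : Matrix (Fin n) (Fin n) ℂ)ᴴ = 1 :=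
    Matrix.mem_unitaryGroup_iff.1 A.2
  have h2 : (A : Matrix (Fin n) (Fin n) ℂ).map star * (A : Matrix (Fin n) (Fin n) ℂ)ᵀ = 1 := by
    have h := congrArg (fun M : Matrix (Fin n) (Fin n) ℂ => M.map (starRingEnd ℂ)) h1
    simp only [Matrix.map_mul] at h
    rw [Matrix.map_one _ (map_zero _) (map_one _)] at h
    have h' : (A : Matrix (Fin n) (Fin n) ℂ)ᵀ =
        (A : Matrix (Fin n) (Fin n) ℂ)ᴴ.map (starRingEnd ℂ) := by
      ext i j
      simp
    rw [h']
    exact h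
  have h3 : ((A : Matrix (Fin n) (Fin n) ℂ).map star)ᵀ = (A : Matrix (Fin n) (Fin n) ℂ)ᴴ := rfl
  have h4 : ((A : Matrix (Fin n) (Fin n) ℂ).map star)ᴴ = (A : Matrix (Fin n) (Fin n) ℂ)ᵀ := by
    ext i j
    simp
  refine ⟨?_, ?_⟩
  · change _ ∈ Matrix.unitaryGroup (Fin n ⊕ Fin n) ℂ
    rw [Matrix.mem_unitaryGroup_iff, Matrix.star_eq_conjTranspose, Matrix.fromBlocks_conjTranspose,
      Matrix.fromBlocks_multiply, h4, h1, h2]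
    simp
  · change _ ∈ Matrix.symplecticGroup (Fin n) ℂ
    rw [SymplecticGroup.mem_iff, Matrix.J, Matrix.fromBlocks_transpose,
      Matrix.fromBlocks_multiply, Matrix.fromBlocks_multiply, h3]
    simp only [Matrix.mul_zero, Matrix.zero_mul, Matrix.mul_neg, Matrix.neg_mul, Matrix.mul_one,
      Matrix.transpose_zero, add_zero, zero_add, neg_zero, h1, h2]

/-- The embedding `U(n) → Sp(n)`, `A ↦ diag(A, Ā)`. -/
def unitaryEmbedding (n : ℕ) : Matrix.unitaryGroup (Fin n) ℂ →* Sp n where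
  toFun A := ⟨Matrix.fromBlocks (A : Matrix (Fin n) (Fin n) ℂ) 0 0
    ((A : Matrix (Fin n) (Fin n) ℂ).map star), fromBlocks_mem_Sp A⟩
  map_one' := by
    apply Subtype.ext
    simp
  map_mul' A B := by
    apply Subtype.ext
    change _ = (_ : BlockMat n) * (_ : BlockMat n)
    rw [Matrix.fromBlocks_multiply]
    simp

/-- `U(n)` as a subgroup of `Sp(n)`. -/
def U (n : ℕ) : Subgroup (Sp n) := (unitaryEmbedding n).range

/-- `I_{n,n} = diag(I_n, -I_n)`. -/
def Inn (n : ℕ) : BlockMat n := Matrix.fromBlocks 1 0 0 (-1)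

/-- The Lagrangian adjoint `X^L = I_{n,n} X^H I_{n,n}`. -/
def lagAdj {n : ℕ} (X : BlockMat n) : BlockMat n := Inn n * Xᴴ * Inn n

/-- The real vector space `V²(ℂ²ⁿ)` of Lagrangian symmetric matrices. -/
def V2 (n : ℕ) : Submodule ℝ (BlockMat n) where
  carrier := {X | X = lagAdj X}
  zero_mem' := by simp [lagAdj]
  add_mem' {X Y} hX hY := by
    change X + Y = lagAdj (X + Y)
    simp only [lagAdj, Matrix.conjTranspose_add, Matrix.mul_add, Matrix.add_mul]
    exact congrArg₂ (· + ·) hX hY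
  smul_mem' c X hX := by
    change c • X = lagAdj (c • X)
    simp only [lagAdj, Matrix.conjTranspose_smul, star_trivial, Matrix.mul_smul, Matrix.smul_mul]
    exact congrArg (c • ·) hX

/-- The set `{Q Q^L : Q ∈ Sp(n)}`. -/
def QQL (n : ℕ) : Set (BlockMat n) := {X | ∃ Q ∈ Sp n, X = Q * lagAdj Q}

/-- The standard complex symplectic form `ω(v, w) = vᵀ J w` on `ℂ²ⁿ`. -/
def omega (n : ℕ) : LinearMap.BilinForm ℂ (Fin n ⊕ Fin n → ℂ) :=
  Matrix.toBilin' (Matrix.J (Fin n) ℂ)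

/-- The Lagrangian Grassmannian `LGr(ℂ²ⁿ)`: the complex subspaces `L` of `ℂ²ⁿ` that equal their
orthogonal complement with respect to the standard complex symplectic form. -/
def LGr (n : ℕ) : Type :=
  {L : Submodule ℂ (Fin n ⊕ Fin n → ℂ) // (omega n).orthogonal L = L}

theorem omega_mulVec {n : ℕ} (A : Matrix.symplecticGroup (Fin n) ℂ) (v w : Fin n ⊕ Fin n → ℂ) :
    omega n ((A : BlockMat n) *ᵥ v) ((A : BlockMat n) *ᵥ w) = omega n v w := by
  have h : (A : BlockMat n)ᵀ * Matrix.J (Fin n) ℂ * (A : BlockMat n) = Matrix.J (Fin n) ℂ :=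
    SymplecticGroup.mem_iff'.1 A.2
  simp only [omega, Matrix.toBilin'_apply']
  conv_rhs => rw [← h, ← Matrix.mulVec_mulVec, ← Matrix.mulVec_mulVec, Matrix.dotProduct_mulVec,
    Matrix.vecMul_transpose]

/-- The action `(A, L) ↦ A L` of `Sp(2n, ℂ)` on Lagrangian subspaces. -/
def LGr.act {n : ℕ} (A : Matrix.symplecticGroup (Fin n) ℂ) (L : LGr n) : LGr n :=
  ⟨L.1.map (Matrix.toLin' (A : BlockMat n)), by
    have hinv : ∀ v : Fin n ⊕ Fin n → ℂ,
        (A : BlockMat n) *ᵥ (((A⁻¹ : Matrix.symplecticGroup (Fin n) ℂ) : BlockMat n) *ᵥ v) = v := by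
      intro v
      have h : (A : BlockMat n) * ((A⁻¹ : Matrix.symplecticGroup (Fin n) ℂ) : BlockMat n) = 1 :=
        congrArg Subtype.val (mul_inv_cancel A)
      rw [Matrix.mulVec_mulVec, h, Matrix.one_mulVec]
    ext m
    rw [LinearMap.BilinForm.mem_orthogonal_iff]
    constructor
    · intro h
      refine ⟨_, ?_, hinv m⟩
      rw [← L.2]
      change _ ∈ (omega n).orthogonal L.1
      rw [LinearMap.BilinForm.mem_orthogonal_iff]
      intro w hw
      have h' := h _ ⟨w, hw, rfl⟩
      rw [← omega_mulVec A, hinv]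
      exact h'
    · rintro ⟨v, hv, rfl⟩ _ ⟨w, hw, rfl⟩
      rw [Matrix.toLin'_apply, Matrix.toLin'_apply, omega_mulVec]
      have hv' : v ∈ (omega n).orthogonal L.1 := by rw [L.2]; exact hv
      exact (LinearMap.BilinForm.mem_orthogonal_iff.1 hv') w hw⟩

/-- The real vector space of complex symmetric `n × n` matrices, given by their entries. -/
def Sym (n : ℕ) : Submodule ℝ (Fin n → Fin n → ℂ) where
  carrier := {S | ∀ i j, S i j = S j i}
  zero_mem' := fun _ _ => rfl
  add_mem' {S T} hS hT i j := by
    simp only [Pi.add_apply, hS i j, hT i j]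
  smul_mem' c S hS i j := by
    simp only [Pi.smul_apply, hS i j]

/-- An element of `Sym n` as a matrix. -/
def Sym.toMatrix {n : ℕ} (S : Sym n) : Matrix (Fin n) (Fin n) ℂ := Matrix.of S.1

/-- The Lagrangian subspace `{(x, S x) : x ∈ ℂⁿ}` for a complex symmetric matrix `S`. -/
def LGr.graph {n : ℕ} (S : Sym n) : LGr n :=
  ⟨LinearMap.range (Matrix.toLin' (Matrix.fromRows 1 (Sym.toMatrix S))), by
    have hS : (Sym.toMatrix S)ᵀ = Sym.toMatrix S := by
      ext i j
      exact S.2 j i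
    ext m
    rw [LinearMap.BilinForm.mem_orthogonal_iff]
    have key : ∀ x : Fin n → ℂ, omega n (Sum.elim x ((Sym.toMatrix S) *ᵥ x)) m =
        x ⬝ᵥ ((Sym.toMatrix S) *ᵥ (m ∘ Sum.inl) - m ∘ Sum.inr) := by
      intro x
      rw [omega, Matrix.toBilin'_apply', Matrix.J, Matrix.fromBlocks_mulVec,
        sumElim_dotProduct_sumElim]
      rw [dotProduct_sub, Matrix.dotProduct_mulVec x, ← Matrix.mulVec_transpose, hS]
      simp [Matrix.neg_mulVec]
      ring
    constructor
    · intro h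
      refine ⟨m ∘ Sum.inl, ?_⟩
      have h0 : (Sym.toMatrix S) *ᵥ (m ∘ Sum.inl) - m ∘ Sum.inr = 0 := by
        apply dotProduct_eq_zero
        intro x
        rw [dotProduct_comm, ← key]
        refine h _ ⟨x, ?_⟩
        rw [Matrix.toLin'_apply, Matrix.fromRows_mulVec, Matrix.one_mulVec]
      rw [Matrix.toLin'_apply, Matrix.fromRows_mulVec, Matrix.one_mulVec, sub_eq_zero.1 h0]
      exact Sum.elim_comp_inl_inr m
    · rintro ⟨y, rfl⟩ _ ⟨x, rfl⟩
      simp only [Matrix.toLin'_apply, Matrix.fromRows_mulVec, Matrix.one_mulVec] at key ⊢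
      rw [key]
      simp⟩

/-- The affine parametrization `S ↦ A {(x, S x) : x ∈ ℂⁿ}` of the Lagrangian subspaces that are
transversal to the Lagrangian subspace `A ({0} × ℂⁿ)`. -/
def LGr.param {n : ℕ} (A : Matrix.symplecticGroup (Fin n) ℂ) (S : Sym n) : LGr n :=
  LGr.act A (LGr.graph S)

/-- The manifold topology: a set is open if and only if its preimage under every
affine parametrization is open. -/
instance (n : ℕ) : TopologicalSpace (LGr n) :=
  ⨆ A : Matrix.symplecticGroup (Fin n) ℂ, TopologicalSpace.coinduced (LGr.param A) inferInstance

/-- The coordinate Lagrangian subspace `ℂⁿ × {0}`. -/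
def LGr.std (n : ℕ) : LGr n := LGr.graph 0

end ComplexLagrangian

end

/-! All four spaces are realised as embedded subsets of the space of `2n × 2n` matrices: `Sp n` and
`QQL n` by inclusion, `Sp n ⧸ U n` by `[Q] ↦ Q Q^L` (`quotEmb`), and `LGr n` by `L ↦ (2P - 1)
I_{n,n}` with `P` the orthogonal projection onto `L` (`LGr.emb`). If `L = Q(ℂⁿ × {0})`, then `2P - 1
= Q I_{n,n} Qᴴ`, so this matrix is again `Q Q^L`. The last three spaces thus have the same image,
and two embedded submanifolds with one image are diffeomorphic over the ambient space
(`exists_diffeomorph_of_range_eq`). Equivariance follows from the formula on representatives.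

The smooth structures come from slice charts. The Cayley transform `Z ↦ (1 - Z)(1 + Z)⁻¹` is an
involution that turns the equations of `Sp n` into the linear ones of its Lie algebra and respects
`X = X^L` (`cayley_mem_spLie_iff`, `cayley_mem_symLie_iff`). Translating it by `Sp n` gives charts
around every point, and the dimensions are counted in the linear models.

Three facts tie this to the given structures. `Sp n` is transitive on `LGr n`
(`LGr.exists_act_std`), and a matrix of `Sp n` with `X = X^L` gives an involution `X I_{n,n}` whose
fixed space is Lagrangian, so it lies in `QQL n` (`mem_QQL_iff`). Each `LGr.param A` has an explicit
smooth inverse in terms of `Q Q^L`, which yields both the embedding (`LGr.isEmbedding_emb`) and the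
local diffeomorphisms. The quotient embeds by compactness, and its projection is a submersion
because `Z ↦ Q cayley(Z)` is transverse to the fibres (`fderiv_quotEmb_symCurve_injective`). -/

/-! ### Slice charts and embedded submanifolds -/

section Slice

variable {V E M : Type*} [NormedAddCommGroup V] [NormedSpace ℝ V]
  [NormedAddCommGroup E] [NormedSpace ℝ E]

/-- A smooth chart of `V` which straightens the subset `S` to the linear subspace `W`. -/
structure SliceChart (W : Submodule ℝ V) (S : Set V) where
  /-- The underlying chart of `V`. -/
  chart : OpenPartialHomeomorph V V
  contDiffOn_chart : ContDiffOn ℝ ∞ chart chart.source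
  contDiffOn_symm : ContDiffOn ℝ ∞ chart.symm chart.target
  mem_iff : ∀ y ∈ chart.source, y ∈ S ↔ chart y ∈ W

namespace SliceChart

variable {W : Submodule ℝ V} {S : Set V} {j : M → V} [Nonempty M]

theorem symm_mem (c : SliceChart W S) {w : V} (hw : w ∈ W) (ht : w ∈ c.chart.target) :
    c.chart.symm w ∈ S := by
  rw [c.mem_iff _ (c.chart.map_target ht), c.chart.right_inv ht]
  exact hw

theorem apply_invFun (c : SliceChart W S) (hS : Set.range j = S) {w : V} (hw : w ∈ W)
    (ht : w ∈ c.chart.target) : j (Function.invFun j (c.chart.symm w)) = c.chart.symm w := by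
  have h : c.chart.symm w ∈ Set.range j := hS ▸ c.symm_mem hw ht
  exact Function.invFun_eq h

variable [TopologicalSpace M] (f : E ≃L[ℝ] W) (r : V →L[ℝ] W) (hr : ∀ w : W, r w = w)

/-- The chart of an embedded space induced by a slice chart of the ambient space. -/
noncomputable def restrict (c : SliceChart W S) (hj : Topology.IsEmbedding j)
    (hS : Set.range j = S) : OpenPartialHomeomorph M E where
  toFun m := f.symm (r (c.chart (j m)))
  -- A genuine preimage on the target: there the inverse slice chart lands in `S`, which is the
  -- range of `j`.
  invFun z := Function.invFun j (c.chart.symm (f z))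
  source := j ⁻¹' c.chart.source
  target := {z | (f z : V) ∈ c.chart.target}
  map_source' m hm := by
    have hm' : c.chart (j m) ∈ W := (c.mem_iff _ hm).1 (hS ▸ Set.mem_range_self m)
    have := hr ⟨_, hm'⟩
    simp only [Set.mem_ofPred_eq, ContinuousLinearEquiv.apply_symm_apply]
    rw [this]
    exact c.chart.map_source hm
  map_target' z hz := by
    rw [Set.mem_preimage, c.apply_invFun hS (f z).2 hz]
    exact c.chart.map_target hz
  left_inv' m hm := by
    have hm' : c.chart (j m) ∈ W := (c.mem_iff _ hm).1 (hS ▸ Set.mem_range_self m)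
    have := hr ⟨_, hm'⟩
    simp only [ContinuousLinearEquiv.apply_symm_apply]
    rw [this]
    simp only
    rw [c.chart.left_inv hm]
    exact Function.leftInverse_invFun hj.injective m
  right_inv' z hz := by
    rw [c.apply_invFun hS (f z).2 hz, c.chart.right_inv hz, hr, f.symm_apply_apply]
  open_source := c.chart.open_source.preimage hj.continuous
  open_target := c.chart.open_target.preimage (continuous_subtype_val.comp f.continuous)
  continuousOn_toFun := (f.symm.continuous.comp r.continuous).comp_continuousOn
    (c.chart.continuousOn.comp hj.continuous.continuousOn fun _ hm => hm)
  continuousOn_invFun := by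
    rw [hj.continuousOn_iff]
    refine (c.chart.continuousOn_symm.comp (continuous_subtype_val.comp f.continuous).continuousOn
      fun _ hz => hz).congr fun z hz => ?_
    exact c.apply_invFun hS (f z).2 hz

theorem apply_restrict_symm (c : SliceChart W S) (hj : Topology.IsEmbedding j)
    (hS : Set.range j = S) {z : E} (hz : z ∈ (c.restrict f r hr hj hS).target) :
    j ((c.restrict f r hr hj hS).symm z) = c.chart.symm (f z) :=
  c.apply_invFun hS (f z).2 hz

theorem contDiffOn_transition (c d : SliceChart W S) (hj : Topology.IsEmbedding j)
    (hS : Set.range j = S) :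
    ContDiffOn ℝ ∞ ((c.restrict f r hr hj hS).symm.trans (d.restrict f r hr hj hS))
      ((c.restrict f r hr hj hS).symm.trans (d.restrict f r hr hj hS)).source := by
  have h1 : ContDiffOn ℝ ∞ (fun z : E => f.symm (r (d.chart (c.chart.symm (f z)))))
      ((c.restrict f r hr hj hS).symm.trans (d.restrict f r hr hj hS)).source := by
    refine (f.symm.contDiff.comp r.contDiff).comp_contDiffOn ?_
    refine d.contDiffOn_chart.comp (c.contDiffOn_symm.comp
      (W.subtypeL.contDiff.comp f.contDiff).contDiffOn fun z hz => hz.1) fun z hz => ?_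
    have h2 : j ((c.restrict f r hr hj hS).symm z) ∈ d.chart.source := hz.2
    rw [c.apply_restrict_symm f r hr hj hS hz.1] at h2
    exact h2
  refine h1.congr fun z hz => ?_
  change f.symm (r (d.chart (j ((c.restrict f r hr hj hS).symm z)))) = _
  rw [c.apply_restrict_symm f r hr hj hS hz.1]

end SliceChart

/-- A space embedded in a finite-dimensional space, with slice charts around each of its
points, is an embedded smooth submanifold. -/
theorem exists_smooth_structure_of_sliceCharts [TopologicalSpace M] [FiniteDimensional ℝ V]
    {W : Submodule ℝ V} {S : Set V} {k : ℕ} (hk : Module.finrank ℝ W = k) {j : M → V}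
    (hj : Topology.IsEmbedding j) (hS : Set.range j = S) (c : ∀ y ∈ S, ∃ c : SliceChart W S, y ∈ c.chart.source) :
    ∃ _ : ChartedSpace (EuclideanSpace ℝ (Fin k)) M,
      IsManifold (𝓡 k) ∞ M ∧ Manifold.IsSmoothEmbedding (𝓡 k) 𝓘(ℝ, V) ∞ j := by
  let f : EuclideanSpace ℝ (Fin k) ≃L[ℝ] W := ContinuousLinearEquiv.ofFinrankEq (by simp [hk])
  -- A linear retraction of `V` onto `W` makes the restricted charts maps defined without reference
  -- to membership in `W`; its kernel later serves as the complement of `W`.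
  obtain ⟨p, hp⟩ := W.subtype.exists_leftInverse_of_injective W.ker_subtype
  let r : V →L[ℝ] W := LinearMap.toContinuousLinearMap p
  have hr : ∀ w : W, r w = w := fun w => LinearMap.congr_fun hp w
  choose c hc using c
  have hm : ∀ m : M, j m ∈ S := fun m => hS ▸ Set.mem_range_self m
  let φ : M → OpenPartialHomeomorph M (EuclideanSpace ℝ (Fin k)) := fun m =>
    haveI : Nonempty M := ⟨m⟩
    (c (j m) (hm m)).restrict f r hr hj hS
  let cs : ChartedSpace (EuclideanSpace ℝ (Fin k)) M :=
    { atlas := Set.range φ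
      chartAt := φ
      mem_chart_source := fun m => hc (j m) (hm m)
      chart_mem_atlas := fun m => Set.mem_range_self m }
  have hM : IsManifold (𝓡 k) ∞ M := by
    refine isManifold_of_contDiffOn _ _ _ ?_
    rintro _ _ ⟨m, rfl⟩ ⟨m', rfl⟩
    have : Nonempty M := ⟨m⟩
    have h := (c (j m) (hm m)).contDiffOn_transition f r hr (c (j m') (hm m')) hj hS
    exact h.mono fun z hz => hz.1
  refine ⟨cs, hM, ⟨?_, hj⟩⟩
  -- The splitting `V = W ⊕ ker r`. In a slice chart `j` becomes `z ↦ (z, 0)` for it, which is the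
  -- normal form of an immersion.
  let g : (EuclideanSpace ℝ (Fin k) × r.ker) ≃L[ℝ] V :=
    ContinuousLinearEquiv.equivOfInverse
      ((W.subtypeL.comp f.toContinuousLinearMap).coprod r.ker.subtypeL)
      ((f.symm.toContinuousLinearMap.comp r).prod
        ((ContinuousLinearMap.id ℝ V - W.subtypeL.comp r).codRestrict r.ker (by
          intro v
          simp [hr])))
      (by
        rintro ⟨z, w, hw⟩
        have hw' : r w = 0 := hw
        refine Prod.ext ?_ (Subtype.ext ?_) <;> simp [hr, hw'])
      (by
        intro v
        simp)
  refine Manifold.IsImmersionOfComplement.isImmersion (F := r.ker) fun m => ?_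
  have : Nonempty M := ⟨m⟩
  refine Manifold.IsImmersionAtOfComplement.mk_of_charts g (φ m) (c (j m) (hm m)).chart
    (hc (j m) (hm m)) (hc (j m) (hm m)) (IsManifold.chart_mem_maximalAtlas (I := 𝓡 k) m) ?_
    (fun _ h => h) ?_
  · refine OpenPartialHomeomorph.mem_maximalAtlas_of_contMDiffOn _ ?_ ?_
    · exact (c (j m) (hm m)).contDiffOn_chart.contMDiffOn
    · exact (c (j m) (hm m)).contDiffOn_symm.contMDiffOn
  · intro z hz
    have hz' : z ∈ (φ m).target := by simpa using hz
    have h1 := (c (j m) (hm m)).apply_restrict_symm f r hr hj hS hz'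
    change (c (j m) (hm m)).chart (j (((c (j m) (hm m)).restrict f r hr hj hS).symm z)) =
      (f z : V) + ((0 : r.ker) : V)
    rw [h1, (c (j m) (hm m)).chart.right_inv hz']
    simp

/-- Two embedded submanifolds with the same image are diffeomorphic over the ambient space. -/
theorem exists_diffeomorph_of_range_eq {M N : Type*} [TopologicalSpace M] [TopologicalSpace N]
    {E' : Type*} [NormedAddCommGroup E'] [NormedSpace ℝ E'] {H H' : Type*} [TopologicalSpace H]
    [TopologicalSpace H'] {I : ModelWithCorners ℝ E H} {I' : ModelWithCorners ℝ E' H'}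
    [ChartedSpace H M] [ChartedSpace H' N] {i : M → V} {j : N → V}
    (hi : Manifold.IsSmoothEmbedding I 𝓘(ℝ, V) ∞ i)
    (hj : Manifold.IsSmoothEmbedding I' 𝓘(ℝ, V) ∞ j) (h : Set.range i = Set.range j) :
    ∃ Φ : M ≃ₘ^∞⟮I, I'⟯ N, ∀ m, j (Φ m) = i m := by
  have h1 : ∀ m, ∃ n, j n = i m := fun m => by
    have : i m ∈ Set.range j := h ▸ Set.mem_range_self m
    exact this
  have h2 : ∀ n, ∃ m, i m = j n := fun n => by
    have : j n ∈ Set.range i := h ▸ Set.mem_range_self n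
    exact this
  choose F hF using h1
  choose G hG using h2
  have hFc : j ∘ F = i := funext hF
  have hGc : i ∘ G = j := funext hG
  refine ⟨⟨⟨F, G, fun m => hi.isEmbedding.injective (by rw [hG, hF]),
    fun n => hj.isEmbedding.injective (by rw [hF, hG])⟩, ?_, ?_⟩, hF⟩
  -- A continuous map into an immersed manifold is smooth once its composite with the immersion is;
  -- here that composite is `i`.
  · refine (ContMDiff.iff_comp_isImmersion hj.isImmersion).2 ⟨?_, ?_⟩
    · rw [hj.isEmbedding.continuous_iff]
      exact hFc ▸ hi.isEmbedding.continuous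
    · exact hFc ▸ hi.contMDiff
  · refine (ContMDiff.iff_comp_isImmersion hi.isImmersion).2 ⟨?_, ?_⟩
    · rw [hi.isEmbedding.continuous_iff]
      exact hGc ▸ hj.isEmbedding.continuous
    · exact hGc ▸ hj.contMDiff

end Slice

/-! ### Entrywise smoothness of matrix-valued maps -/

section MatrixSmooth

variable {X : Type*} [NormedAddCommGroup X] [NormedSpace ℝ X] {l m k : Type*}

/-- A matrix-valued function is smooth at a point if all of its entries are. -/
def MatrixSmoothAt (f : X → Matrix l m ℂ) (x : X) : Prop :=
  ∀ i j, ContDiffAt ℝ ∞ (fun y => f y i j) x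

namespace MatrixSmoothAt

variable {x : X}

theorem const (A : Matrix l m ℂ) : MatrixSmoothAt (fun _ : X => A) x :=
  fun _ _ => contDiffAt_const

theorem mul [Fintype m] {f : X → Matrix l m ℂ} {g : X → Matrix m k ℂ} (hf : MatrixSmoothAt f x)
    (hg : MatrixSmoothAt g x) : MatrixSmoothAt (fun y => f y * g y) x := fun i j => by
  simp only [Matrix.mul_apply]
  exact ContDiffAt.sum fun a _ => (hf i a).mul (hg a j)

theorem add {f g : X → Matrix l m ℂ} (hf : MatrixSmoothAt f x)
    (hg : MatrixSmoothAt g x) : MatrixSmoothAt (fun y => f y + g y) x :=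
  fun i j => (hf i j).add (hg i j)

theorem sub {f g : X → Matrix l m ℂ} (hf : MatrixSmoothAt f x)
    (hg : MatrixSmoothAt g x) : MatrixSmoothAt (fun y => f y - g y) x :=
  fun i j => (hf i j).sub (hg i j)

theorem conjTranspose {f : X → Matrix l m ℂ} (hf : MatrixSmoothAt f x) :
    MatrixSmoothAt (fun y => (f y)ᴴ) x :=
  fun i j => Complex.conjCLE.contDiff.contDiffAt.comp x (hf j i)

theorem det [Fintype m] [DecidableEq m] {f : X → Matrix m m ℂ} (hf : MatrixSmoothAt f x) :
    ContDiffAt ℝ ∞ (fun y => (f y).det) x := by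
  simp only [Matrix.det_apply']
  exact ContDiffAt.sum fun σ _ => contDiffAt_const.mul (contDiffAt_prod fun i _ => hf _ _)

theorem inv [Fintype m] [DecidableEq m] {f : X → Matrix m m ℂ} (hf : MatrixSmoothAt f x)
    (h : (f x).det ≠ 0) : MatrixSmoothAt (fun y => (f y)⁻¹) x := fun i j => by
  simp only [Matrix.inv_def, Ring.inverse_eq_inv', Matrix.smul_apply, Matrix.adjugate_apply,
    smul_eq_mul]
  -- By Cramer's rule an entry of the adjugate is the determinant of the matrix with one row
  -- replaced by a constant row.
  refine (hf.det.inv h).mul (MatrixSmoothAt.det fun a b => ?_)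
  rcases eq_or_ne a j with rfl | ha
  · simp only [Matrix.updateRow_self]
    exact contDiffAt_const
  · simp only [Matrix.updateRow_ne ha]
    exact hf a b

theorem contDiffAt [Fintype l] [Fintype m] {f : X → Matrix l m ℂ} (hf : MatrixSmoothAt f x) :
    ContDiffAt ℝ ∞ (fun y => Matrix.of.symm (f y)) x :=
  contDiffAt_pi.2 fun i => contDiffAt_pi.2 fun j => hf i j

theorem of_contDiffAt [Fintype l] [Fintype m] {f : X → l → m → ℂ} (hf : ContDiffAt ℝ ∞ f x) :
    MatrixSmoothAt (fun y => Matrix.of (f y)) x :=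
  fun i j => contDiffAt_pi.1 (contDiffAt_pi.1 hf i) j

theorem of_id [Fintype l] [Fintype m] {x : l → m → ℂ} :
    MatrixSmoothAt (fun y : l → m → ℂ => Matrix.of y) x :=
  of_contDiffAt contDiffAt_id

end MatrixSmoothAt

end MatrixSmooth

/-! ### The Cayley transform -/

section Cayley

variable {m : Type*} [Fintype m] [DecidableEq m]

/-- The Cayley transform `X ↦ (1 - X) (1 + X)⁻¹`. -/
noncomputable def cayley (X : Matrix m m ℂ) : Matrix m m ℂ := (1 - X) * (1 + X)⁻¹

theorem one_add_mul_cayley {X : Matrix m m ℂ} (h : (1 + X).det ≠ 0) :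
    (1 + X) * cayley X = 1 - X := by
  have h' : IsUnit (1 + X).det := h.isUnit
  have hc : (1 + X) * (1 - X) = (1 - X) * (1 + X) := by noncomm_ring
  rw [cayley, ← mul_assoc, hc, mul_assoc, Matrix.mul_nonsing_inv _ h', mul_one]

theorem cayley_mul_one_add {X : Matrix m m ℂ} (h : (1 + X).det ≠ 0) :
    cayley X * (1 + X) = 1 - X := by
  rw [cayley, mul_assoc, Matrix.nonsing_inv_mul _ h.isUnit, mul_one]

/-- Removes the inverse from the definition, so that later identities for `cayley` become polynomial
ones. -/
theorem eq_cayley_iff {X Y : Matrix m m ℂ} (h : (1 + X).det ≠ 0) :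
    Y = cayley X ↔ Y * (1 + X) = 1 - X := by
  refine ⟨fun e => e ▸ cayley_mul_one_add h, fun e => ?_⟩
  rw [cayley, ← e, mul_assoc, Matrix.mul_nonsing_inv _ h.isUnit, mul_one]

/-- The reason is `(1 + cayley X)(1 + X) = 2`. Hence the domain of the transform is stable under it.
-/
theorem det_one_add_cayley_ne_zero {X : Matrix m m ℂ} (h : (1 + X).det ≠ 0) :
    (1 + cayley X).det ≠ 0 := by
  have h1 : (1 + cayley X) * (1 + X) = (2 : ℂ) • 1 := by
    rw [add_mul, cayley_mul_one_add h, one_mul, two_smul]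
    abel
  have h2 := congrArg Matrix.det h1
  rw [Matrix.det_mul, Matrix.det_smul, Matrix.det_one, mul_one] at h2
  exact left_ne_zero_of_mul (h2.trans_ne (pow_ne_zero _ two_ne_zero))

theorem cayley_cayley {X : Matrix m m ℂ} (h : (1 + X).det ≠ 0) : cayley (cayley X) = X := by
  symm
  rw [eq_cayley_iff (det_one_add_cayley_ne_zero h)]
  have h1 := one_add_mul_cayley h
  rw [add_mul, one_mul] at h1
  rw [mul_add, mul_one, ← sub_eq_zero]
  rw [← sub_eq_zero] at h1
  rw [← h1]
  abel

theorem cayley_conjTranspose (X : Matrix m m ℂ) (h : (1 + X).det ≠ 0) :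
    (cayley X)ᴴ = cayley Xᴴ := by
  have h' : (1 + Xᴴ).det ≠ 0 := by
    rw [← Matrix.conjTranspose_one, ← Matrix.conjTranspose_add, Matrix.det_conjTranspose]
    exact star_ne_zero.2 h
  rw [eq_cayley_iff h']
  have := congrArg Matrix.conjTranspose (one_add_mul_cayley h)
  simpa [Matrix.conjTranspose_mul] using this

theorem cayley_transpose (X : Matrix m m ℂ) (h : (1 + X).det ≠ 0) :
    (cayley X)ᵀ = cayley Xᵀ := by
  have h' : (1 + Xᵀ).det ≠ 0 := by
    rwa [← Matrix.transpose_one, ← Matrix.transpose_add, Matrix.det_transpose]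
  rw [eq_cayley_iff h']
  have := congrArg Matrix.transpose (one_add_mul_cayley h)
  simpa [Matrix.transpose_mul] using this

/-- The Cayley transform turns the group-like condition `Z' K Z = K` into its infinitesimal
version. -/
theorem mul_mul_eq_iff_cayley {Z Z' K : Matrix m m ℂ} (h : (1 + Z).det ≠ 0)
    (h' : (1 + Z').det ≠ 0) : Z' * K * Z = K ↔ cayley Z' * K = -(K * cayley Z) := by
  -- Clearing denominators on both sides: `(1 - Z')K(1 + Z) + (1 + Z')K(1 - Z) = 2(K - Z'KZ)`.
  have key : (1 + Z') * (cayley Z' * K + K * cayley Z) * (1 + Z) =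
      (2 : ℂ) • (K - Z' * K * Z) := by
    calc _ = ((1 + Z') * cayley Z') * K * (1 + Z) + (1 + Z') * K * (cayley Z * (1 + Z)) := by
          noncomm_ring
      _ = _ := by
          rw [one_add_mul_cayley h', cayley_mul_one_add h, two_smul]
          noncomm_ring
  rw [eq_neg_iff_add_eq_zero]
  constructor
  · intro e
    rw [e, sub_self, smul_zero] at key
    have h1 := congrArg (fun A => (1 + Z')⁻¹ * A * (1 + Z)⁻¹) key
    simpa only [mul_assoc, Matrix.mul_nonsing_inv _ h.isUnit, mul_one,
      Matrix.nonsing_inv_mul_cancel_left _ _ h'.isUnit, mul_zero, zero_mul] using h1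
  · intro e
    rw [e, mul_zero, zero_mul, eq_comm, smul_eq_zero_iff_right two_ne_zero, sub_eq_zero] at key
    exact key.symm

theorem cayley_conj {U W : Matrix m m ℂ} (hU : U * U = 1) (h : (1 + W).det ≠ 0) :
    U * cayley W * U = cayley (U * W * U) := by
  have h1 : 1 + U * W * U = U * (1 + W) * U := by rw [mul_add, add_mul, mul_one, hU]
  have hd : U.det ≠ 0 := fun hd => by
    have := congrArg Matrix.det hU
    simp [hd] at this
  have h2 : (1 + U * W * U).det ≠ 0 := by
    rw [h1, Matrix.det_mul, Matrix.det_mul]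
    exact mul_ne_zero (mul_ne_zero hd h) hd
  rw [eq_cayley_iff h2, h1]
  calc U * cayley W * U * (U * (1 + W) * U) = U * cayley W * (U * U) * (1 + W) * U := by
        noncomm_ring
    _ = U * (cayley W * (1 + W)) * U := by rw [hU]; noncomm_ring
    _ = _ := by rw [cayley_mul_one_add h, mul_sub, sub_mul, mul_one, hU]

theorem MatrixSmoothAt.cayley {X : Type*} [NormedAddCommGroup X] [NormedSpace ℝ X] {x : X}
    {f : X → Matrix m m ℂ} (hf : MatrixSmoothAt f x) (h : (1 + f x).det ≠ 0) :
    MatrixSmoothAt (fun y => cayley (f y)) x :=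
  ((const 1).sub hf).mul (((const 1).add hf).inv h)

/-- The chart `X ↦ cayley (P⁻¹ X R⁻¹)` of the space of matrices. -/
noncomputable def cayleyChart (P R : (Matrix m m ℂ)ˣ) :
    OpenPartialHomeomorph (m → m → ℂ) (m → m → ℂ) where
  toFun X := Matrix.of.symm (cayley ((P⁻¹ : (Matrix m m ℂ)ˣ) * Matrix.of X * (R⁻¹ : (Matrix m m ℂ)ˣ)))
  invFun Y := Matrix.of.symm (P * cayley (Matrix.of Y) * R)
  source := {X | (1 + (P⁻¹ : (Matrix m m ℂ)ˣ) * Matrix.of X * (R⁻¹ : (Matrix m m ℂ)ˣ)).det ≠ 0}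
  target := {Y | (1 + Matrix.of Y).det ≠ 0}
  map_source' X hX := det_one_add_cayley_ne_zero hX
  map_target' Y hY := by
    have h := det_one_add_cayley_ne_zero hY
    simpa [mul_assoc] using h
  left_inv' X hX := by
    simp only [Equiv.apply_symm_apply]
    rw [cayley_cayley hX]
    simp [mul_assoc]
  right_inv' Y hY := by
    have h := cayley_cayley hY
    simp only [Equiv.apply_symm_apply]
    simp [mul_assoc, h]
  open_source := isOpen_ne_fun (Continuous.matrix_det (continuous_const.add
    ((continuous_const.matrix_mul continuous_id).matrix_mul continuous_const))) continuous_const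
  open_target := isOpen_ne_fun (Continuous.matrix_det (continuous_const.add continuous_id))
    continuous_const
  continuousOn_toFun X hX := (MatrixSmoothAt.cayley (((MatrixSmoothAt.const _).mul
    .of_id).mul (.const _)) hX).contDiffAt.continuousAt.continuousWithinAt
  continuousOn_invFun Y hY := (((MatrixSmoothAt.const _).mul
    (MatrixSmoothAt.cayley .of_id hY)).mul (.const _)).contDiffAt.continuousAt.continuousWithinAt

theorem contDiffOn_cayleyChart (P R : (Matrix m m ℂ)ˣ) :
    ContDiffOn ℝ ∞ (cayleyChart P R) (cayleyChart P R).source := fun _ hX =>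
  (MatrixSmoothAt.cayley (((MatrixSmoothAt.const _).mul
    .of_id).mul (.const _)) hX).contDiffAt.contDiffWithinAt

theorem contDiffOn_cayleyChart_symm (P R : (Matrix m m ℂ)ˣ) :
    ContDiffOn ℝ ∞ (cayleyChart P R).symm (cayleyChart P R).target := fun _ hY =>
  (((MatrixSmoothAt.const _).mul
    (MatrixSmoothAt.cayley .of_id hY)).mul (.const _)).contDiffAt.contDiffWithinAt

end Cayley

/-! ### The Lagrangian adjoint and the linear models of the slice charts -/

namespace ComplexLagrangian

variable {n : ℕ}

theorem mem_Sp_iff {Q : BlockMat n} :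
    Q ∈ Sp n ↔ Qᴴ * 1 * Q = 1 ∧ Qᵀ * Matrix.J (Fin n) ℂ * Q = Matrix.J (Fin n) ℂ := by
  rw [mul_one, ← SymplecticGroup.mem_iff', ← Matrix.star_eq_conjTranspose,
    ← Matrix.mem_unitaryGroup_iff']
  rfl

theorem Inn_mul_Inn : Inn n * Inn n = 1 := by
  simp [Inn, Matrix.fromBlocks_multiply]

theorem Inn_conjTranspose : (Inn n)ᴴ = Inn n := by
  simp [Inn, Matrix.fromBlocks_conjTranspose]

theorem Inn_transpose : (Inn n)ᵀ = Inn n := by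
  simp [Inn, Matrix.fromBlocks_transpose]

theorem Inn_mul_J_mul_Inn : Inn n * Matrix.J (Fin n) ℂ * Inn n = -Matrix.J (Fin n) ℂ := by
  simp [Inn, Matrix.J, Matrix.fromBlocks_multiply, Matrix.fromBlocks_neg]

theorem lagAdj_mul (X Y : BlockMat n) : lagAdj (X * Y) = lagAdj Y * lagAdj X := by
  simp only [lagAdj, Matrix.conjTranspose_mul]
  calc _ = Inn n * Yᴴ * 1 * Xᴴ * Inn n := by noncomm_ring
    _ = _ := by rw [← Inn_mul_Inn]; noncomm_ring

theorem lagAdj_lagAdj (X : BlockMat n) : lagAdj (lagAdj X) = X := by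
  simp only [lagAdj, Matrix.conjTranspose_mul, Inn_conjTranspose, Matrix.conjTranspose_conjTranspose]
  calc _ = (Inn n * Inn n) * X * (Inn n * Inn n) := by noncomm_ring
    _ = _ := by rw [Inn_mul_Inn, one_mul, mul_one]

theorem lagAdj_one : lagAdj (1 : BlockMat n) = 1 := by
  simp [lagAdj, Inn_mul_Inn]

theorem lagAdj_mem_Sp {Q : BlockMat n} (hQ : Q ∈ Sp n) : lagAdj Q ∈ Sp n := by
  have h := mem_Sp_iff.1 (conjTranspose_mem_Sp hQ)
  rw [mem_Sp_iff]
  constructor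
  · rw [mul_one] at h ⊢
    simp only [lagAdj, Matrix.conjTranspose_mul, Inn_conjTranspose]
    calc _ = Inn n * (Qᴴᴴ * (Inn n * Inn n) * Qᴴ) * Inn n := by noncomm_ring
      _ = _ := by rw [Inn_mul_Inn, mul_one, h.1, mul_one, Inn_mul_Inn]
  · simp only [lagAdj, Matrix.transpose_mul, Inn_transpose]
    calc _ = Inn n * (Qᴴᵀ * (Inn n * Matrix.J (Fin n) ℂ * Inn n) * Qᴴ) * Inn n := by noncomm_ring
      -- Conjugation by `I_{n,n}` negates `J`; it is used twice, so the two signs cancel.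
      _ = -(Inn n * (Qᴴᵀ * Matrix.J (Fin n) ℂ * Qᴴ) * Inn n) := by
          rw [Inn_mul_J_mul_Inn]; noncomm_ring
      _ = _ := by rw [h.2, Inn_mul_J_mul_Inn, neg_neg]

/-- An element of `Sp(n)` as an invertible matrix. -/
def toUnits {Q : BlockMat n} (hQ : Q ∈ Sp n) : (BlockMat n)ˣ where
  val := Q
  inv := Qᴴ
  val_inv := Matrix.mem_unitaryGroup_iff.1 hQ.1
  inv_val := Matrix.mem_unitaryGroup_iff'.1 hQ.1

theorem lagAdj_cayley {Z : BlockMat n} (h : (1 + Z).det ≠ 0) :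
    lagAdj (cayley Z) = cayley (lagAdj Z) := by
  have h' : (1 + Zᴴ).det ≠ 0 := by
    rw [← Matrix.conjTranspose_one, ← Matrix.conjTranspose_add, Matrix.det_conjTranspose]
    exact star_ne_zero.2 h
  rw [lagAdj, cayley_conjTranspose _ h, cayley_conj Inn_mul_Inn h']
  rfl

theorem det_one_add_lagAdj_ne_zero {Z : BlockMat n} (h : (1 + Z).det ≠ 0) :
    (1 + lagAdj Z).det ≠ 0 := by
  have h1 : 1 + lagAdj Z = Inn n * (1 + Z)ᴴ * Inn n := by
    rw [Matrix.conjTranspose_add, mul_add, add_mul, Matrix.conjTranspose_one, mul_one, Inn_mul_Inn]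
    rfl
  have hd : (Inn n).det ≠ 0 := fun hd => by
    have := congrArg Matrix.det (Inn_mul_Inn (n := n))
    simp [hd] at this
  rw [h1, Matrix.det_mul, Matrix.det_mul, Matrix.det_conjTranspose]
  exact mul_ne_zero (mul_ne_zero hd (star_ne_zero.2 h)) hd

/-- The Lie algebra of `Sp(n)`. -/
def spLie (n : ℕ) : Submodule ℝ (Entries n) where
  carrier := {Y | (Matrix.of Y)ᴴ = -Matrix.of Y ∧
    (Matrix.of Y)ᵀ * Matrix.J (Fin n) ℂ = -(Matrix.J (Fin n) ℂ * Matrix.of Y)}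
  zero_mem' := by simp
  add_mem' {X Y} hX hY := by
    change (Matrix.of X + Matrix.of Y)ᴴ = -(Matrix.of X + Matrix.of Y) ∧
      (Matrix.of X + Matrix.of Y)ᵀ * Matrix.J (Fin n) ℂ =
        -(Matrix.J (Fin n) ℂ * (Matrix.of X + Matrix.of Y))
    rw [Matrix.conjTranspose_add, Matrix.transpose_add, add_mul, mul_add, hX.1, hY.1, hX.2, hY.2]
    exact ⟨(neg_add _ _).symm, (neg_add _ _).symm⟩
  smul_mem' c X hX := by
    change (c • Matrix.of X)ᴴ = -(c • Matrix.of X) ∧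
      (c • Matrix.of X)ᵀ * Matrix.J (Fin n) ℂ = -(Matrix.J (Fin n) ℂ * (c • Matrix.of X))
    rw [Matrix.conjTranspose_smul, Matrix.transpose_smul, Matrix.smul_mul, Matrix.mul_smul,
      hX.1, hX.2, star_trivial]
    exact ⟨smul_neg _ _, smul_neg _ _⟩

/-- The matrices of the Lie algebra of `Sp(n)` that are fixed by the Lagrangian adjoint. -/
def symLie (n : ℕ) : Submodule ℝ (Entries n) where
  carrier := {Y | Y ∈ spLie n ∧ Matrix.of Y ∈ V2 n}
  zero_mem' := ⟨zero_mem _, zero_mem _⟩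
  add_mem' hX hY := ⟨add_mem hX.1 hY.1, add_mem hX.2 hY.2⟩
  smul_mem' c _ hX := ⟨Submodule.smul_mem _ c hX.1, Submodule.smul_mem _ c hX.2⟩

/-- Both equations of `Sp n` have the form `Z' K Z = K`, with `(Z', K) = (Zᴴ, 1)` and `(Zᵀ, J)`, and
the Cayley transform commutes with `ᴴ` and `ᵀ`. -/
theorem cayley_mem_spLie_iff {Z : BlockMat n} (h : (1 + Z).det ≠ 0) :
    Matrix.of.symm (cayley Z) ∈ spLie n ↔ Z ∈ Sp n := by
  have h1 : (1 + Zᴴ).det ≠ 0 := by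
    rw [← Matrix.conjTranspose_one, ← Matrix.conjTranspose_add, Matrix.det_conjTranspose]
    exact star_ne_zero.2 h
  have h2 : (1 + Zᵀ).det ≠ 0 := by
    rwa [← Matrix.transpose_one, ← Matrix.transpose_add, Matrix.det_transpose]
  rw [mem_Sp_iff, mul_mul_eq_iff_cayley h h1, mul_mul_eq_iff_cayley h h2, mul_one, one_mul,
    ← cayley_conjTranspose Z h, ← cayley_transpose Z h]
  rfl

theorem cayley_mem_symLie_iff {Z : BlockMat n} (h : (1 + Z).det ≠ 0) :
    Matrix.of.symm (cayley Z) ∈ symLie n ↔ Z ∈ Sp n ∧ Z = lagAdj Z := by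
  refine and_congr (cayley_mem_spLie_iff h) ?_
  change cayley Z = lagAdj (cayley Z) ↔ _
  rw [lagAdj_cayley h]
  refine ⟨fun e => ?_, fun e => by rw [← e]⟩
  exact (cayley_cayley h).symm.trans
    ((congrArg cayley e).trans (cayley_cayley (det_one_add_lagAdj_ne_zero h)))

/-- The linear parametrization of the Lie algebra of `Sp(n)`. -/
noncomputable def spLieParam (n : ℕ) :
    (Fin n → Fin n → ℝ) × (Sym2 (Fin n) → ℂ) →ₗ[ℝ] Entries n where
  toFun p := Sum.elim
    (fun i => Sum.elim
      -- One real matrix encodes a skew-Hermitian block: its antisymmetric part gives the real part,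
      -- its symmetric part the imaginary part.
      (fun j => ((p.1 i j - p.1 j i : ℝ) : ℂ) + ((p.1 i j + p.1 j i : ℝ) : ℂ) * Complex.I)
      fun j => -star (p.2 s(i, j)))
    fun i => Sum.elim (fun j => p.2 s(i, j))
      fun j => -(((p.1 j i - p.1 i j : ℝ) : ℂ) + ((p.1 j i + p.1 i j : ℝ) : ℂ) * Complex.I)
  map_add' p q := by
    ext (i | i) (j | j) <;> simp <;> ring
  map_smul' c p := by
    ext (i | i) (j | j) <;> simp <;> ring

theorem spLieParam_injective : Function.Injective (spLieParam n) := by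
  rw [injective_iff_map_eq_zero]
  rintro ⟨a, s⟩ h
  have h1 : ∀ i j, a i j = 0 := fun i j => by
    have h2 := congrFun (congrFun h (Sum.inl i)) (Sum.inl j)
    have hr := congrArg Complex.re h2
    have hi := congrArg Complex.im h2
    simp [spLieParam] at hr hi
    linarith
  have h3 : ∀ i j, s s(i, j) = 0 := fun i j => congrFun (congrFun h (Sum.inr i)) (Sum.inl j)
  refine Prod.ext (funext fun i => funext fun j => h1 i j) (funext fun z => ?_)
  induction z with
  | _ i j => exact h3 i j

/-- In blocks: the upper left is skew-Hermitian and the lower left symmetric, and these two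
determine the other blocks. -/
theorem mem_spLie_iff {Y : Entries n} : Y ∈ spLie n ↔
    (∀ i j, star (Y (.inl j) (.inl i)) = -Y (.inl i) (.inl j)) ∧
    (∀ i j, Y (.inr i) (.inl j) = Y (.inr j) (.inl i)) ∧
    (∀ i j, Y (.inl i) (.inr j) = -star (Y (.inr j) (.inl i))) ∧
    ∀ i j, Y (.inr i) (.inr j) = -Y (.inl j) (.inl i) := by
  have hJ1 : ∀ (X : BlockMat n) a, (X * Matrix.J (Fin n) ℂ) a =
      Sum.elim (fun j => X a (.inr j)) fun j => -X a (.inl j) := fun X a => by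
    ext (j | j) <;> simp [Matrix.J, Matrix.mul_apply, Matrix.one_apply]
  have hJ2 : ∀ (X : BlockMat n) a, (Matrix.J (Fin n) ℂ * X) a =
      Sum.elim (fun i => -X (.inr i)) (fun i => X (.inl i)) a := fun X a => by
    ext b
    rcases a with i | i <;> simp [Matrix.J, Matrix.mul_apply, Matrix.one_apply]
  change (_ = _ ∧ _ = _) ↔ _
  simp only [← Matrix.ext_iff, hJ1, hJ2, Matrix.neg_apply, Matrix.conjTranspose_apply,
    Matrix.transpose_apply, Sum.forall, Matrix.of_apply, Sum.elim_inl, Sum.elim_inr, Pi.neg_apply]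
  constructor
  · rintro ⟨⟨h1, h2⟩, ⟨h3, h4⟩⟩
    refine ⟨fun i j => (h1 i).1 j, fun i j => ?_, fun i j => ?_, fun i j => ?_⟩
    · simpa using ((h3 j).1 i)
    · rw [(h1 i).2 j, neg_neg]
    · exact (h4 j).1 i
  · rintro ⟨h1, h2, h3, h4⟩
    refine ⟨⟨fun i => ⟨fun j => h1 i j, fun j => ?_⟩, fun i => ⟨fun j => ?_, fun j => ?_⟩⟩,
      fun i => ⟨fun j => ?_, fun j => ?_⟩, fun i => ⟨fun j => ?_, fun j => ?_⟩⟩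
    · rw [h3, neg_neg]
    · rw [h3, star_neg, star_star]
    · rw [h4, h4, star_neg, h1]
    · rw [neg_neg, h2]
    · rw [h4, neg_neg]
    · rw [h4]
    · rw [h3, h3, h2]

theorem range_spLieParam : LinearMap.range (spLieParam n) = spLie n := by
  ext Y
  rw [mem_spLie_iff]
  constructor
  · rintro ⟨⟨a, s⟩, rfl⟩
    refine ⟨fun i j => ?_, fun i j => ?_, fun i j => ?_, fun i j => ?_⟩
    · apply Complex.ext <;> simp [spLieParam] <;> ring
    · change s s(i, j) = s s(j, i)
      rw [Sym2.eq_swap]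
    · change -star (s s(i, j)) = -star (s s(j, i))
      rw [Sym2.eq_swap]
    · rfl
  · rintro ⟨h1, h2, h3, h4⟩
    -- Real plus imaginary part of the encoded entry is `2 a i j`, since the `a j i` terms cancel.
    refine ⟨(fun i j => ((Y (.inl i) (.inl j)).re + (Y (.inl i) (.inl j)).im) / 2,
      Sym2.lift ⟨fun i j => Y (.inr i) (.inl j), h2⟩), ?_⟩
    have key : ∀ i j, (spLieParam n (fun i j => ((Y (.inl i) (.inl j)).re +
        (Y (.inl i) (.inl j)).im) / 2, Sym2.lift ⟨fun i j => Y (.inr i) (.inl j), h2⟩))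
        (.inl i) (.inl j) = Y (.inl i) (.inl j) := fun i j => by
      have hr := congrArg Complex.re (h1 i j)
      have hi := congrArg Complex.im (h1 i j)
      simp at hr hi
      apply Complex.ext <;> simp [spLieParam] <;> linarith
    ext (i | i) (j | j)
    · exact key i j
    · rw [h3, h2]
      rfl
    · rfl
    · rw [h4, ← key j i]
      rfl

theorem finrank_sym2 : Module.finrank ℝ (Sym2 (Fin n) → ℂ) = n * (n + 1) := by
  rw [Module.finrank_pi_fintype]
  simp only [Complex.finrank_real_complex, Finset.sum_const, Finset.card_univ, Sym2.card,
    Fintype.card_fin, smul_eq_mul, Nat.choose_two_right, Nat.add_sub_cancel]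
  rw [Nat.div_mul_cancel (Nat.even_mul_succ_self n |>.two_dvd.trans (by rw [mul_comm])), mul_comm]

theorem finrank_spLie : Module.finrank ℝ (spLie n) = n * (2 * n + 1) := by
  rw [← range_spLieParam, LinearMap.finrank_range_of_inj spLieParam_injective,
    Module.finrank_prod, finrank_sym2]
  simp only [Module.finrank_pi_fintype, Module.finrank_self, Finset.sum_const, Finset.card_univ,
    Fintype.card_fin, smul_eq_mul, mul_one]
  ring

/-- For skew-Hermitian `Y` the condition `Y = Y^L` reads `Y = -I_{n,n} Y I_{n,n}`, which says
exactly that the diagonal blocks vanish. Only the symmetric block remains free. -/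
theorem range_spLieParam_inr :
    LinearMap.range ((spLieParam n).comp (LinearMap.inr ℝ _ _)) = symLie n := by
  have hI : ∀ Y : Entries n, Y ∈ spLie n → (Matrix.of Y ∈ V2 n ↔
      ∀ i j, Y (.inl i) (.inl j) = 0) := by
    intro Y hY
    have h1 : (Matrix.of Y)ᴴ = -Matrix.of Y := hY.1
    change Matrix.of Y = Inn n * (Matrix.of Y)ᴴ * Inn n ↔ _
    have h2 : ∀ X : BlockMat n, Inn n * X * Inn n =
        Matrix.fromBlocks X.toBlocks₁₁ (-X.toBlocks₁₂) (-X.toBlocks₂₁) X.toBlocks₂₂ := fun X => by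
      conv_lhs => rw [← Matrix.fromBlocks_toBlocks X]
      simp [Inn, Matrix.fromBlocks_multiply]
    rw [h1, h2]
    constructor
    · intro e i j
      have := congrFun (congrFun e (.inl i)) (.inl j)
      simp [Matrix.toBlocks₁₁] at this
      exact self_eq_neg.1 this
    · intro h
      have h4 := (mem_spLie_iff.1 hY).2.2.2
      ext (i | i) (j | j) <;>
        simp [Matrix.toBlocks₁₁, Matrix.toBlocks₁₂, Matrix.toBlocks₂₁, Matrix.toBlocks₂₂, h, h4]
  ext Y
  constructor
  · rintro ⟨s, rfl⟩
    have hs : spLieParam n (0, s) ∈ spLie n := range_spLieParam.le ⟨_, rfl⟩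
    exact ⟨hs, (hI _ hs).2 fun i j => by simp [spLieParam]⟩
  · rintro ⟨hs, hY⟩
    have h0 := (hI _ hs).1 hY
    obtain ⟨⟨a, s⟩, rfl⟩ := range_spLieParam.ge hs
    have ha : a = 0 := by
      ext i j
      have h2 := h0 i j
      have hr := congrArg Complex.re h2
      have hi := congrArg Complex.im h2
      simp [spLieParam] at hr hi
      simp only [Pi.zero_apply]
      linarith
    exact ⟨s, by rw [ha]; rfl⟩

theorem finrank_symLie : Module.finrank ℝ (symLie n) = n * (n + 1) := by
  rw [← range_spLieParam_inr]
  exact (LinearMap.finrank_range_of_inj (f := (spLieParam n).comp (LinearMap.inr ℝ _ _))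
    (spLieParam_injective.comp LinearMap.inr_injective)).trans finrank_sym2

end ComplexLagrangian

/-! ### Orthogonal projections and their ranges -/

section Projection

variable {m k : Type*} [Fintype m] [DecidableEq m] [Fintype k] [DecidableEq k]

/-- The condition that a matrix is an orthogonal projection. -/
def IsOrthProj (P : Matrix m m ℂ) : Prop := Pᴴ = P ∧ P * P = P

theorem mul_eq_of_range_le {P : Matrix m m ℂ} (hP : P * P = P) {M : Matrix m k ℂ}
    (h : LinearMap.range (Matrix.toLin' M) ≤ LinearMap.range (Matrix.toLin' P)) : P * M = M := by
  apply Matrix.toLin'.injective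
  ext1 x
  obtain ⟨y, hy⟩ := h ⟨Pi.single x 1, rfl⟩
  ext1
  simp only [LinearMap.comp_apply, LinearMap.coe_single]
  rw [Matrix.toLin'_mul_apply, ← hy, ← Matrix.toLin'_mul_apply, hP]

omit [Fintype m] [DecidableEq m] in
theorem range_mul_le {l : Type*} [Fintype l] [DecidableEq l] (M : Matrix m k ℂ)
    (N : Matrix k l ℂ) :
    LinearMap.range (Matrix.toLin' (M * N)) ≤ LinearMap.range (Matrix.toLin' M) := by
  rw [Matrix.toLin'_mul]
  exact LinearMap.range_comp_le_range _ _

/-- Equal ranges give `P P' = P'` and `P' P = P`; the adjoint of the second is `P P' = P`. -/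
theorem IsOrthProj.eq_of_range_eq {P P' : Matrix m m ℂ} (hP : IsOrthProj P) (hP' : IsOrthProj P')
    (h : LinearMap.range (Matrix.toLin' P) = LinearMap.range (Matrix.toLin' P')) : P = P' := by
  have h1 := mul_eq_of_range_le hP.2 h.ge
  have h2 := congrArg Matrix.conjTranspose (mul_eq_of_range_le hP'.2 h.le)
  rw [Matrix.conjTranspose_mul, hP.1, hP'.1] at h2
  rw [← h2, h1]

/-- The orthogonal projection onto the column space of a matrix of full column rank. -/
noncomputable def colProj (M : Matrix m k ℂ) : Matrix m m ℂ := M * (Mᴴ * M)⁻¹ * Mᴴ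

-- A left inverse makes `M` injective, so its Gram matrix is positive definite.
omit [DecidableEq m] in
open scoped ComplexOrder in
theorem det_gram_ne_zero {M : Matrix m k ℂ} {N : Matrix k m ℂ} (h : N * M = 1) :
    (Mᴴ * M).det ≠ 0 := by
  refine (Matrix.PosDef.conjTranspose_mul_self M ?_).det_pos.ne'
  refine Function.LeftInverse.injective (g := N.mulVec) fun x => ?_
  rw [Matrix.mulVec_mulVec, h, Matrix.one_mulVec]

omit [DecidableEq m] in
theorem isOrthProj_colProj {M : Matrix m k ℂ} (h : (Mᴴ * M).det ≠ 0) :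
    IsOrthProj (colProj M) := by
  constructor
  · simp only [colProj, Matrix.conjTranspose_mul, Matrix.conjTranspose_conjTranspose,
      Matrix.conjTranspose_nonsing_inv, Matrix.mul_assoc]
  · calc _ = M * ((Mᴴ * M)⁻¹ * (Mᴴ * M)) * (Mᴴ * M)⁻¹ * Mᴴ := by
          simp only [colProj, Matrix.mul_assoc]
      _ = _ := by rw [Matrix.nonsing_inv_mul _ h.isUnit, Matrix.mul_one, colProj]

theorem range_colProj {M : Matrix m k ℂ} (h : (Mᴴ * M).det ≠ 0) :
    LinearMap.range (Matrix.toLin' (colProj M)) = LinearMap.range (Matrix.toLin' M) := by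
  apply le_antisymm
  · rw [colProj, Matrix.mul_assoc]
    exact range_mul_le _ _
  · have h1 : colProj M * M = M := by
      rw [colProj, Matrix.mul_assoc, Matrix.mul_assoc, Matrix.nonsing_inv_mul _ h.isUnit,
        Matrix.mul_one]
    conv_lhs => rw [← h1]
    exact range_mul_le _ _

end Projection

/-! ### Transitivity of `Sp n` and the matrix of a Lagrangian subspace -/

noncomputable section

namespace ComplexLagrangian

variable {n : ℕ}

theorem omega_apply (v w : Fin n ⊕ Fin n → ℂ) :
    omega n v w = v ⬝ᵥ Matrix.J (Fin n) ℂ *ᵥ w := by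
  rw [omega, Matrix.toBilin'_apply']

theorem transpose_mul_J_mul_apply {k : Type*} (M N : Matrix (Fin n ⊕ Fin n) k ℂ) (i j : k) :
    (Mᵀ * Matrix.J (Fin n) ℂ * N) i j = omega n (M.col i) (N.col j) := by
  rw [omega_apply, Matrix.mul_assoc, Matrix.mul_apply']
  rfl

/-- Taking orthogonals reverses inclusions and fixes Lagrangian subspaces. -/
theorem LGr.eq_of_le {L L' : LGr n} (h : L.1 ≤ L'.1) : L = L' := by
  refine Subtype.ext (le_antisymm h ?_)
  rw [← L.2, ← L'.2]
  exact LinearMap.BilinForm.orthogonal_le h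

theorem LGr.omega_eq_zero (L : LGr n) {v w : Fin n ⊕ Fin n → ℂ} (hv : v ∈ L.1) (hw : w ∈ L.1) :
    omega n v w = 0 := by
  have hw' : w ∈ (omega n).orthogonal L.1 := by rwa [L.2]
  exact LinearMap.BilinForm.mem_orthogonal_iff.1 hw' v hv

theorem LGr.transpose_mul_J_mul_eq_zero (L : LGr n) {k : Type*} [Fintype k] [DecidableEq k]
    {M : Matrix (Fin n ⊕ Fin n) k ℂ} (h : LinearMap.range (Matrix.toLin' M) ≤ L.1) :
    Mᵀ * Matrix.J (Fin n) ℂ * M = 0 := by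
  ext i j
  rw [transpose_mul_J_mul_apply]
  have hc : ∀ i, M.col i ∈ L.1 := fun i => h ⟨Pi.single i 1, by simp⟩
  exact L.omega_eq_zero (hc i) (hc j)

theorem omega_nondegenerate : (omega n).Nondegenerate :=
  Matrix.nondegenerate_toBilin'_iff.2
    (Matrix.nondegenerate_of_det_ne_zero (Matrix.isUnit_det_J _ _).ne_zero)

theorem LGr.finrank_eq (L : LGr n) : Module.finrank ℂ L.1 = n := by
  have h := LinearMap.BilinForm.finrank_orthogonal (omega_nondegenerate (n := n)) L.1
  have h' : Module.finrank ℂ ((omega n).orthogonal L.1) = Module.finrank ℂ L.1 :=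
    congrArg (fun W : Submodule ℂ (Fin n ⊕ Fin n → ℂ) => Module.finrank ℂ W) L.2
  have hle := Submodule.finrank_le L.1
  rw [h'] at h
  simp only [Module.finrank_fintype_fun_eq_card, Fintype.card_sum, Fintype.card_fin] at h hle
  omega

/-- The matrix whose columns span the graph of `T`. -/
def graphFrame (T : Matrix (Fin n) (Fin n) ℂ) : Matrix (Fin n ⊕ Fin n) (Fin n) ℂ :=
  Matrix.fromRows 1 T

theorem LGr.param_val (A : Matrix.symplecticGroup (Fin n) ℂ) (S : Sym n) :
    (LGr.param A S).1 =
      LinearMap.range (Matrix.toLin' ((A : BlockMat n) * graphFrame (Sym.toMatrix S))) := by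
  change Submodule.map (Matrix.toLin' (A : BlockMat n))
    (LinearMap.range (Matrix.toLin' (Matrix.fromRows 1 (Sym.toMatrix S)))) = _
  rw [← LinearMap.range_comp, ← Matrix.toLin'_mul, graphFrame]

/-- The matrix whose columns are the first `n` standard basis vectors. -/
def stdFrame (n : ℕ) : Matrix (Fin n ⊕ Fin n) (Fin n) ℂ := Matrix.fromRows 1 0

theorem LGr.act_std_val (A : Matrix.symplecticGroup (Fin n) ℂ) :
    (LGr.act A (LGr.std n)).1 = LinearMap.range (Matrix.toLin' ((A : BlockMat n) * stdFrame n)) :=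
  LGr.param_val A 0

theorem LGr.exists_orthonormal_frame (L : LGr n) : ∃ M : Matrix (Fin n ⊕ Fin n) (Fin n) ℂ,
    Mᴴ * M = 1 ∧ LinearMap.range (Matrix.toLin' M) ≤ L.1 := by
  -- The function space carries the sup norm, so the Hermitian inner product is borrowed from
  -- `EuclideanSpace`.
  let e : (Fin n ⊕ Fin n → ℂ) ≃ₗ[ℂ] EuclideanSpace ℂ (Fin n ⊕ Fin n) :=
    (WithLp.linearEquiv 2 ℂ (Fin n ⊕ Fin n → ℂ)).symm
  let L' := L.1.map e.toLinearMap
  have hd : Module.finrank ℂ L' = n := (LinearEquiv.finrank_map_eq e L.1).trans L.finrank_eq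
  let b := (stdOrthonormalBasis ℂ L').reindex (finCongr hd)
  have hb : ∀ i, (b i : EuclideanSpace ℂ (Fin n ⊕ Fin n)).ofLp ∈ L.1 := fun i => by
    obtain ⟨v, hv, h⟩ := (b i).2
    rw [← h]
    exact hv
  refine ⟨Matrix.of fun a i => (b i : EuclideanSpace ℂ (Fin n ⊕ Fin n)).ofLp a, ?_, ?_⟩
  · ext i j
    have h := orthonormal_iff_ite.1 b.orthonormal i j
    rw [Submodule.coe_inner, EuclideanSpace.inner_eq_star_dotProduct, dotProduct_comm] at h
    rw [Matrix.one_apply, ← h]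
    rfl
  · rintro _ ⟨x, rfl⟩
    rw [Matrix.toLin'_apply, Matrix.mulVec_eq_sum]
    refine Submodule.sum_mem _ fun i _ => ?_
    rw [op_smul_eq_smul]
    exact Submodule.smul_mem _ _ (hb i)

/-- An orthonormal isotropic frame `M` is completed to `Q = [M, J M̄]`, where `M̄ = Mᴴᵀ`. Isotropy
makes the two halves of the columns orthogonal, and `J² = -1` gives the symplectic relations. -/
theorem exists_mem_Sp_mul_stdFrame {M : Matrix (Fin n ⊕ Fin n) (Fin n) ℂ} (h1 : Mᴴ * M = 1)
    (h2 : Mᵀ * Matrix.J (Fin n) ℂ * M = 0) : ∃ Q ∈ Sp n, Q * stdFrame n = M := by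
  have e1 : Mᴴᵀᴴ = Mᵀ := by ext; simp
  have e2 : Mᵀᴴ = Mᴴᵀ := by ext; simp
  have h3 : Mᵀ * Mᴴᵀ = 1 := by rw [← Matrix.transpose_mul, h1, Matrix.transpose_one]
  have hJ : (Matrix.J (Fin n) ℂ)ᴴ = -Matrix.J (Fin n) ℂ := by
    simp [Matrix.J, Matrix.fromBlocks_conjTranspose, Matrix.fromBlocks_neg]
  have hJJ := Matrix.J_squared (Fin n) ℂ
  have hJ' := Matrix.J_transpose (Fin n) ℂ
  have h4 : Mᴴ * Matrix.J (Fin n) ℂ * Mᴴᵀ = 0 := by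
    have h := congrArg Matrix.conjTranspose h2
    rw [Matrix.conjTranspose_mul, Matrix.conjTranspose_mul, hJ, e2, Matrix.conjTranspose_zero,
      Matrix.neg_mul, Matrix.mul_neg, neg_eq_zero, ← Matrix.mul_assoc] at h
    exact h
  have h5 : Mᵀ * (Matrix.J (Fin n) ℂ * (Matrix.J (Fin n) ℂ * Mᴴᵀ)) = -1 := by
    rw [← Matrix.mul_assoc (Matrix.J (Fin n) ℂ), hJJ, Matrix.neg_mul, Matrix.one_mul,
      Matrix.mul_neg, h3]
  rw [Matrix.mul_assoc] at h2 h4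
  refine ⟨Matrix.fromCols M (Matrix.J (Fin n) ℂ * Mᴴᵀ), mem_Sp_iff.2 ⟨?_, ?_⟩, ?_⟩
  · rw [mul_one, Matrix.conjTranspose_fromCols_eq_fromRows_conjTranspose,
      Matrix.fromRows_mul_fromCols, Matrix.conjTranspose_mul, hJ, e1, h1, h4, Matrix.mul_assoc,
      Matrix.mul_assoc, Matrix.neg_mul, Matrix.neg_mul, Matrix.mul_neg, Matrix.mul_neg, h2, h5]
    simp
  · rw [Matrix.transpose_fromCols, Matrix.fromRows_mul, Matrix.fromRows_mul_fromCols,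
      Matrix.transpose_mul, hJ', Matrix.transpose_transpose]
    simp only [Matrix.mul_assoc, Matrix.mul_neg, Matrix.neg_mul, h2, h5]
    rw [← Matrix.mul_assoc (Matrix.J (Fin n) ℂ), ← Matrix.mul_assoc (Matrix.J (Fin n) ℂ) _
      (Matrix.J (Fin n) ℂ * Mᴴᵀ), hJJ]
    simp only [Matrix.neg_mul, Matrix.mul_neg, Matrix.one_mul, h1, h4]
    simp [Matrix.J]
  · rw [stdFrame, Matrix.fromCols_mul_fromRows, Matrix.mul_one, Matrix.mul_zero, add_zero]

theorem LGr.exists_act_std (L : LGr n) : ∃ Q : Sp n, LGr.act (toSymplectic Q) (LGr.std n) = L := by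
  obtain ⟨M, h1, h2⟩ := L.exists_orthonormal_frame
  obtain ⟨Q, hQ, h⟩ := exists_mem_Sp_mul_stdFrame h1 (L.transpose_mul_J_mul_eq_zero h2)
  refine ⟨⟨Q, hQ⟩, LGr.eq_of_le ?_⟩
  rw [LGr.act_std_val]
  change LinearMap.range (Matrix.toLin' (Q * stdFrame n)) ≤ _
  rwa [h]

theorem stdFrame_mul_conjTranspose :
    (2 : ℂ) • (stdFrame n * (stdFrame n)ᴴ) - 1 = Inn n := by
  rw [stdFrame, Matrix.conjTranspose_fromRows_eq_fromCols_conjTranspose,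
    Matrix.fromRows_mul_fromCols, two_smul]
  ext (i | i) (j | j) <;> simp [Inn, Matrix.one_apply, Matrix.fromBlocks]

theorem stdFrame_conjTranspose_mul : (stdFrame n)ᴴ * stdFrame n = 1 := by
  rw [stdFrame, Matrix.conjTranspose_fromRows_eq_fromCols_conjTranspose,
    Matrix.fromCols_mul_fromRows]
  simp

/-- The orthogonal projection onto `Q (ℂⁿ × {0})` for `Q ∈ Sp(n)`. -/
def frameProj (Q : BlockMat n) : BlockMat n := Q * stdFrame n * (stdFrame n)ᴴ * Qᴴ

theorem isOrthProj_frameProj {Q : BlockMat n} (hQ : Q ∈ Sp n) : IsOrthProj (frameProj Q) := by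
  have h := mem_Sp_iff.1 hQ
  rw [mul_one] at h
  constructor
  · simp only [frameProj, Matrix.conjTranspose_mul, Matrix.conjTranspose_conjTranspose,
      Matrix.mul_assoc]
  · calc _ = Q * stdFrame n * ((stdFrame n)ᴴ * (Qᴴ * Q) * stdFrame n) * (stdFrame n)ᴴ * Qᴴ := by
          simp only [frameProj, Matrix.mul_assoc]
      _ = _ := by
          rw [h.1, Matrix.mul_one, stdFrame_conjTranspose_mul, Matrix.mul_one, frameProj]

theorem range_frameProj (Q : Sp n) : LinearMap.range (Matrix.toLin' (frameProj (Q : BlockMat n))) =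
    (LGr.act (toSymplectic Q) (LGr.std n)).1 := by
  have h := mem_Sp_iff.1 Q.2
  rw [mul_one] at h
  rw [LGr.act_std_val]
  apply le_antisymm
  · rw [frameProj, Matrix.mul_assoc]
    exact range_mul_le _ _
  · have h1 : frameProj (Q : BlockMat n) * ((Q : BlockMat n) * stdFrame n) =
        (Q : BlockMat n) * stdFrame n := by
      calc _ = (Q : BlockMat n) * stdFrame n * ((stdFrame n)ᴴ *
            ((Q : BlockMat n)ᴴ * (Q : BlockMat n)) * stdFrame n) := by
            simp only [frameProj, Matrix.mul_assoc]
        _ = _ := by rw [h.1, Matrix.mul_one, stdFrame_conjTranspose_mul, Matrix.mul_one]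
    change LinearMap.range (Matrix.toLin' ((Q : BlockMat n) * stdFrame n)) ≤ _
    conv_lhs => rw [← h1]
    exact range_mul_le _ _

/-- The reflection `2P - 1` in `Q(ℂⁿ × {0})` is the conjugate `Q I_{n,n} Qᴴ` of the standard one.
This links projections to the matrices `Q Q^L`. -/
theorem two_smul_frameProj {Q : BlockMat n} (hQ : Q ∈ Sp n) :
    ((2 : ℂ) • frameProj Q - 1) * Inn n = Q * lagAdj Q := by
  have h : Q * Qᴴ = 1 := Matrix.mem_unitaryGroup_iff.1 hQ.1
  have h1 : (2 : ℂ) • frameProj Q - 1 = Q * Inn n * Qᴴ := by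
    rw [← stdFrame_mul_conjTranspose, mul_sub, sub_mul, mul_one, h]
    simp only [frameProj, Matrix.mul_assoc, Matrix.mul_smul, Matrix.smul_mul]
  rw [h1, lagAdj]
  simp only [Matrix.mul_assoc]

/-- The orthogonal projection onto a Lagrangian subspace. -/
def LGr.proj (L : LGr n) : BlockMat n := frameProj (L.exists_act_std.choose : BlockMat n)

theorem LGr.isOrthProj_proj (L : LGr n) : IsOrthProj L.proj :=
  isOrthProj_frameProj L.exists_act_std.choose.2

theorem LGr.range_proj (L : LGr n) : LinearMap.range (Matrix.toLin' L.proj) = L.1 :=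
  (range_frameProj _).trans (congrArg Subtype.val L.exists_act_std.choose_spec)

/-- The matrix `Q Q^L` of the Lagrangian subspace `Q (ℂⁿ × {0})`. -/
def LGr.toMat (L : LGr n) : BlockMat n := ((2 : ℂ) • L.proj - 1) * Inn n

/-- The projection `P` with `X = (2 P - 1) I_{n,n}`. -/
def matProj (X : BlockMat n) : BlockMat n := (2⁻¹ : ℂ) • (1 + X * Inn n)

theorem LGr.matProj_toMat (L : LGr n) : matProj L.toMat = L.proj := by
  rw [matProj, LGr.toMat, mul_assoc, Inn_mul_Inn, mul_one, add_sub_cancel, smul_smul]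
  norm_num

theorem LGr.toMat_injective : Function.Injective (LGr.toMat (n := n)) := fun L L' h => by
  refine Subtype.ext ?_
  rw [← L.range_proj, ← L'.range_proj, ← L.matProj_toMat, ← L'.matProj_toMat, h]

theorem LGr.toMat_act_std (Q : Sp n) : (LGr.act (toSymplectic Q) (LGr.std n)).toMat =
    (Q : BlockMat n) * lagAdj (Q : BlockMat n) := by
  -- The representative chosen in `LGr.proj` is immaterial, since an orthogonal projection is
  -- determined by its range.
  have h : (LGr.act (toSymplectic Q) (LGr.std n)).proj = frameProj (Q : BlockMat n) :=
    (LGr.isOrthProj_proj _).eq_of_range_eq (isOrthProj_frameProj Q.2)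
      ((LGr.range_proj _).trans (range_frameProj Q).symm)
  rw [LGr.toMat, h, two_smul_frameProj Q.2]

theorem LGr.act_act (A B : Sp n) (L : LGr n) :
    LGr.act (toSymplectic A) (LGr.act (toSymplectic B) L) = LGr.act (toSymplectic (A * B)) L := by
  refine Subtype.ext ?_
  change Submodule.map _ (Submodule.map _ _) = Submodule.map (Matrix.toLin'
    ((A : BlockMat n) * (B : BlockMat n))) _
  rw [Matrix.toLin'_mul, Submodule.map_comp]
  rfl

theorem LGr.range_toMat : Set.range (LGr.toMat (n := n)) = QQL n := by
  ext X
  constructor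
  · rintro ⟨L, rfl⟩
    obtain ⟨Q, rfl⟩ := L.exists_act_std
    exact ⟨Q, Q.2, LGr.toMat_act_std Q⟩
  · rintro ⟨Q, hQ, rfl⟩
    exact ⟨_, LGr.toMat_act_std ⟨Q, hQ⟩⟩

/-- The range of the orthogonal projection `(1 + X I_{n,n}) / 2` is Lagrangian. -/
theorem exists_LGr_of_mem_Sp {X : BlockMat n} (hX : X ∈ Sp n) (h : X = lagAdj X) :
    ∃ L : LGr n, L.toMat = X := by
  have hX' := mem_Sp_iff.1 hX
  rw [mul_one] at hX'
  -- `T` is a Hermitian involution that negates `omega`; `matProj X = (1 + T)/2` projects onto its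
  -- fixed space.
  obtain ⟨T, hT⟩ : ∃ T : BlockMat n, T = X * Inn n := ⟨_, rfl⟩
  have hTH : Tᴴ = T := by
    rw [hT, Matrix.conjTranspose_mul, Inn_conjTranspose]
    conv_rhs => rw [h, lagAdj, mul_assoc, mul_assoc, Inn_mul_Inn, mul_one]
  have hTT : T * T = 1 := by
    have h1 : Tᴴ * T = 1 := by
      rw [hT, Matrix.conjTranspose_mul, Inn_conjTranspose, mul_assoc, ← mul_assoc _ X, hX'.1,
        one_mul, Inn_mul_Inn]
    rwa [hTH] at h1
  have hTJ : Tᵀ * Matrix.J (Fin n) ℂ * T = -Matrix.J (Fin n) ℂ := by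
    rw [hT, Matrix.transpose_mul, Inn_transpose]
    calc _ = Inn n * (Xᵀ * Matrix.J (Fin n) ℂ * X) * Inn n := by simp only [mul_assoc]
      _ = _ := by rw [hX'.2, Inn_mul_J_mul_Inn]
  have hTo : ∀ v w, omega n (T *ᵥ v) (T *ᵥ w) = -omega n v w := fun v w => by
    rw [omega_apply, omega_apply, ← dotProduct_neg, ← Matrix.neg_mulVec, ← hTJ,
      ← Matrix.mulVec_mulVec, ← Matrix.mulVec_mulVec, Matrix.dotProduct_mulVec v Tᵀ,
      Matrix.vecMul_transpose]
  have hTv : ∀ v, T *ᵥ (T *ᵥ v) = v := fun v => by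
    rw [Matrix.mulVec_mulVec, hTT, Matrix.one_mulVec]
  have hP : IsOrthProj (matProj X) := by
    constructor
    · rw [matProj, ← hT, Matrix.conjTranspose_smul, Matrix.conjTranspose_add, hTH]
      simp
    · rw [matProj, ← hT, Matrix.smul_mul, Matrix.mul_smul, smul_smul, add_mul, mul_add T, hTT,
        one_mul, mul_one, add_comm T 1, ← two_smul ℂ (1 + T), smul_smul]
      norm_num
  have hmem : ∀ v, v ∈ LinearMap.range (Matrix.toLin' (matProj X)) ↔ T *ᵥ v = v := by
    intro v
    constructor
    · rintro ⟨w, rfl⟩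
      rw [Matrix.toLin'_apply, matProj, ← hT, Matrix.smul_mulVec, Matrix.mulVec_smul,
        Matrix.add_mulVec, Matrix.mulVec_add, hTv, Matrix.one_mulVec, add_comm]
    · intro hv
      refine ⟨v, ?_⟩
      rw [Matrix.toLin'_apply, matProj, ← hT, Matrix.smul_mulVec, Matrix.add_mulVec,
        Matrix.one_mulVec, hv, ← two_smul ℂ v, smul_smul]
      norm_num
  have hL : (omega n).orthogonal (LinearMap.range (Matrix.toLin' (matProj X))) =
      LinearMap.range (Matrix.toLin' (matProj X)) := by
    ext w
    rw [LinearMap.BilinForm.mem_orthogonal_iff, hmem]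
    constructor
    · intro hw
      -- Since `ω(v, Tw) = -ω(Tv, w)`, the value is `ω(v + Tv, w)`, and `v + Tv` is fixed by `T`.
      -- Nondegeneracy then gives `Tw = w`.
      have h0 : ∀ v, omega n v (w - T *ᵥ w) = 0 := fun v => by
        have h1 : omega n (v + T *ᵥ v) w = 0 := hw _ ((hmem _).2 (by
          rw [Matrix.mulVec_add, hTv, add_comm]))
        have h2 := hTo (T *ᵥ v) w
        rw [hTv] at h2
        rw [map_sub, h2]
        rw [map_add, LinearMap.add_apply] at h1
        rw [sub_neg_eq_add, h1]
      exact (sub_eq_zero.1 (omega_nondegenerate.2 _ h0)).symm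
    · intro hw v hv
      -- Isotropy: for fixed vectors, `ω(v, w) = ω(Tv, Tw) = -ω(v, w)`.
      have h1 := hTo v w
      rw [hw, (hmem v).1 hv] at h1
      exact self_eq_neg.1 h1
  refine ⟨⟨_, hL⟩, ?_⟩
  have hp := (LGr.isOrthProj_proj ⟨_, hL⟩).eq_of_range_eq hP (LGr.range_proj _)
  change ((2 : ℂ) • LGr.proj ⟨_, hL⟩ - 1) * Inn n = X
  rw [hp, matProj, smul_smul, mul_inv_cancel₀ two_ne_zero, one_smul, add_sub_cancel_left,
    mul_assoc, Inn_mul_Inn, mul_one]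

theorem mem_QQL_iff {X : BlockMat n} : X ∈ QQL n ↔ X ∈ Sp n ∧ X = lagAdj X := by
  constructor
  · rintro ⟨Q, hQ, rfl⟩
    exact ⟨mul_mem hQ (lagAdj_mem_Sp hQ), by rw [lagAdj_mul, lagAdj_lagAdj]⟩
  · rintro ⟨hX, h⟩
    rw [← LGr.range_toMat]
    exact exists_LGr_of_mem_Sp hX h

end ComplexLagrangian

end

theorem MatrixSmoothAt.const_smul {X : Type*} [NormedAddCommGroup X] [NormedSpace ℝ X]
    {l m : Type*} {x : X} (c : ℂ) {f : X → Matrix l m ℂ} (hf : MatrixSmoothAt f x) :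
    MatrixSmoothAt (fun y => c • f y) x :=
  fun i j => contDiffAt_const.mul (hf i j)

/-! ### The affine parametrizations of the Lagrangian Grassmannian -/

noncomputable section

namespace ComplexLagrangian

variable {n : ℕ}

theorem graphFrame_conjTranspose_mul_stdFrame (T : Matrix (Fin n) (Fin n) ℂ) :
    (graphFrame T)ᴴ * stdFrame n = 1 := by
  rw [graphFrame, stdFrame, Matrix.conjTranspose_fromRows_eq_fromCols_conjTranspose,
    Matrix.fromCols_mul_fromRows]
  simp

theorem inv_mul_coe (A : Matrix.symplecticGroup (Fin n) ℂ) :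
    ((A⁻¹ : Matrix.symplecticGroup (Fin n) ℂ) : BlockMat n) * (A : BlockMat n) = 1 :=
  congrArg Subtype.val (inv_mul_cancel A)

theorem coe_mul_inv (A : Matrix.symplecticGroup (Fin n) ℂ) :
    (A : BlockMat n) * ((A⁻¹ : Matrix.symplecticGroup (Fin n) ℂ) : BlockMat n) = 1 :=
  congrArg Subtype.val (mul_inv_cancel A)

theorem det_gram_graphFrame_ne_zero (A : Matrix.symplecticGroup (Fin n) ℂ)
    (T : Matrix (Fin n) (Fin n) ℂ) :
    (((A : BlockMat n) * graphFrame T)ᴴ * ((A : BlockMat n) * graphFrame T)).det ≠ 0 := by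
  refine det_gram_ne_zero (N := (stdFrame n)ᴴ *
    ((A⁻¹ : Matrix.symplecticGroup (Fin n) ℂ) : BlockMat n)) ?_
  rw [Matrix.mul_assoc, ← Matrix.mul_assoc _ (A : BlockMat n), inv_mul_coe, Matrix.one_mul]
  have h := congrArg Matrix.conjTranspose (graphFrame_conjTranspose_mul_stdFrame T)
  simpa [Matrix.conjTranspose_mul] using h

theorem LGr.proj_param (A : Matrix.symplecticGroup (Fin n) ℂ) (S : Sym n) :
    (LGr.param A S).proj = colProj ((A : BlockMat n) * graphFrame (Sym.toMatrix S)) := by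
  have h := det_gram_graphFrame_ne_zero A (Sym.toMatrix S)
  refine (LGr.isOrthProj_proj _).eq_of_range_eq (isOrthProj_colProj h) ?_
  rw [LGr.range_proj, range_colProj h, LGr.param_val]

/-- For `X = Q Q^L`, a matrix whose columns span `A⁻¹ Q (ℂⁿ × {0})`, provided that this is a
graph. -/
def paramFrame (A : Matrix.symplecticGroup (Fin n) ℂ) (X : BlockMat n) :
    Matrix (Fin n ⊕ Fin n) (Fin n) ℂ :=
  ((A⁻¹ : Matrix.symplecticGroup (Fin n) ℂ) : BlockMat n) * matProj X *
    ((A⁻¹ : Matrix.symplecticGroup (Fin n) ℂ) : BlockMat n)ᴴ * stdFrame n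

/-- The projection of the space of all matrices to the symmetric ones. -/
def symmetrize (n : ℕ) : (Fin n → Fin n → ℂ) →ₗ[ℝ] Sym n where
  toFun T := ⟨fun i j => 2⁻¹ * (T i j + T j i), fun i j => congrArg (2⁻¹ * ·) (add_comm _ _)⟩
  map_add' S T := by
    ext i j
    simp
    ring
  map_smul' c T := by
    ext i j
    simp
    ring

theorem symmetrize_coe (S : Sym n) : symmetrize n S = S := by
  ext i j
  change 2⁻¹ * (S.1 i j + S.1 j i) = S.1 i j
  rw [S.2 j i]
  ring

/-- The inverse of the parametrization `LGr.param A`, in terms of the matrices `Q Q^L`. -/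
def paramInv (A : Matrix.symplecticGroup (Fin n) ℂ) (X : BlockMat n) : Sym n :=
  -- The slope of the graph is the lower block times the inverse of the upper one. It is already
  -- symmetric for the Lagrangian `X` of interest; symmetrizing only gives a `Sym n` value for every
  -- `X`.
  symmetrize n (Matrix.of.symm ((paramFrame A X).toRows₂ * ((paramFrame A X).toRows₁)⁻¹))

/-- With `F` the frame of the graph and `P = A F G Fᴴ Aᴴ`, the outer factors `A⁻¹` and `A⁻ᴴ` cancel,
and `Fᴴ` times the standard frame is `1`. The remaining factor `G` is an inverse Gram matrix, hence
invertible. -/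
theorem paramFrame_toMat_param (A : Matrix.symplecticGroup (Fin n) ℂ) (S : Sym n) :
    paramFrame A (LGr.param A S).toMat = graphFrame (Sym.toMatrix S) *
      (((A : BlockMat n) * graphFrame (Sym.toMatrix S))ᴴ *
        ((A : BlockMat n) * graphFrame (Sym.toMatrix S)))⁻¹ := by
  have h : (A : BlockMat n)ᴴ * ((A⁻¹ : Matrix.symplecticGroup (Fin n) ℂ) : BlockMat n)ᴴ = 1 := by
    rw [← Matrix.conjTranspose_mul, inv_mul_coe, Matrix.conjTranspose_one]
  rw [paramFrame, LGr.matProj_toMat, LGr.proj_param, colProj]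
  generalize (((A : BlockMat n) * graphFrame (Sym.toMatrix S))ᴴ *
    ((A : BlockMat n) * graphFrame (Sym.toMatrix S)))⁻¹ = G
  calc _ = ((A⁻¹ : Matrix.symplecticGroup (Fin n) ℂ) : BlockMat n) * (A : BlockMat n) *
        graphFrame (Sym.toMatrix S) * G * ((graphFrame (Sym.toMatrix S))ᴴ * ((A : BlockMat n)ᴴ *
          ((A⁻¹ : Matrix.symplecticGroup (Fin n) ℂ) : BlockMat n)ᴴ) * stdFrame n) := by
        simp only [Matrix.conjTranspose_mul, Matrix.mul_assoc]
    _ = _ := by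
        rw [h, inv_mul_coe, Matrix.mul_one, graphFrame_conjTranspose_mul_stdFrame, Matrix.mul_one,
          Matrix.one_mul]

theorem det_toRows_paramFrame_ne_zero (A : Matrix.symplecticGroup (Fin n) ℂ) (S : Sym n) :
    (paramFrame A (LGr.param A S).toMat).toRows₁.det ≠ 0 := by
  rw [paramFrame_toMat_param, graphFrame, Matrix.fromRows_mul, Matrix.toRows₁_fromRows,
    Matrix.one_mul]
  exact (Matrix.isUnit_nonsing_inv_det _ (det_gram_graphFrame_ne_zero A _).isUnit).ne_zero

theorem paramInv_toMat_param (A : Matrix.symplecticGroup (Fin n) ℂ) (S : Sym n) :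
    paramInv A (LGr.param A S).toMat = S := by
  have h := Matrix.isUnit_nonsing_inv_det _
    (det_gram_graphFrame_ne_zero A (Sym.toMatrix S)).isUnit
  rw [paramInv, paramFrame_toMat_param]
  generalize (((A : BlockMat n) * graphFrame (Sym.toMatrix S))ᴴ *
    ((A : BlockMat n) * graphFrame (Sym.toMatrix S)))⁻¹ = G at h
  rw [graphFrame, Matrix.fromRows_mul, Matrix.toRows₁_fromRows, Matrix.toRows₂_fromRows,
    Matrix.one_mul, Matrix.mul_nonsing_inv_cancel_right _ _ h]
  exact symmetrize_coe S

/-- If the upper block `u` is invertible, `L` contains the image under `A` of the graph of `v u⁻¹`.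
Isotropy of `L` forces `v u⁻¹` to be symmetric, and an inclusion of Lagrangian subspaces is an
equality. -/
theorem param_paramInv (A : Matrix.symplecticGroup (Fin n) ℂ) (L : LGr n)
    (h : (paramFrame A L.toMat).toRows₁.det ≠ 0) : LGr.param A (paramInv A L.toMat) = L := by
  set u := (paramFrame A L.toMat).toRows₁ with hu
  set v := (paramFrame A L.toMat).toRows₂ with hv
  have h1 : (A : BlockMat n) * graphFrame (v * u⁻¹) = L.proj *
      (((A⁻¹ : Matrix.symplecticGroup (Fin n) ℂ) : BlockMat n)ᴴ * stdFrame n * u⁻¹) := by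
    have h2 : graphFrame (v * u⁻¹) = paramFrame A L.toMat * u⁻¹ := by
      rw [graphFrame, ← Matrix.fromRows_toRows (paramFrame A L.toMat), Matrix.fromRows_mul, ← hu, ← hv,
        Matrix.mul_nonsing_inv _ h.isUnit]
    rw [h2, paramFrame, LGr.matProj_toMat]
    simp only [← Matrix.mul_assoc]
    rw [coe_mul_inv, Matrix.one_mul]
  have h3 : LinearMap.range (Matrix.toLin' ((A : BlockMat n) * graphFrame (v * u⁻¹))) ≤
      L.1 := by
    rw [h1]
    exact (range_mul_le _ _).trans L.range_proj.le
  have h4 : (v * u⁻¹)ᵀ = v * u⁻¹ := by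
    have h5 := L.transpose_mul_J_mul_eq_zero h3
    have h6 := SymplecticGroup.mem_iff'.1 A.2
    rw [Matrix.transpose_mul] at h5
    have h7 : (graphFrame (v * u⁻¹))ᵀ * ((A : BlockMat n)ᵀ * Matrix.J (Fin n) ℂ *
        (A : BlockMat n)) * graphFrame (v * u⁻¹) = 0 := by
      simpa only [Matrix.mul_assoc] using h5
    rw [h6, graphFrame, Matrix.transpose_fromRows, Matrix.J, Matrix.fromCols_mul_fromBlocks,
      Matrix.fromCols_mul_fromRows] at h7
    simp only [Matrix.mul_zero, Matrix.mul_one, zero_add, add_zero, Matrix.transpose_one,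
      Matrix.mul_neg, Matrix.neg_mul, Matrix.one_mul] at h7
    exact add_neg_eq_zero.1 h7
  refine LGr.eq_of_le ?_
  rw [LGr.param_val]
  have h5 : Sym.toMatrix (paramInv A L.toMat) = v * u⁻¹ :=
    congrArg (fun S : Sym n => Matrix.of S.1) (symmetrize_coe
      ⟨Matrix.of.symm (v * u⁻¹), fun i j => congrFun (congrFun h4.symm i) j⟩)
  rwa [h5]

theorem matrixSmoothAt_matProj (X : Entries n) :
    MatrixSmoothAt (fun X : Entries n => matProj (Matrix.of X)) X :=
  ((MatrixSmoothAt.const _).add (MatrixSmoothAt.of_id.mul (.const _))).const_smul _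

theorem matrixSmoothAt_paramFrame (A : Matrix.symplecticGroup (Fin n) ℂ) (X : Entries n) :
    MatrixSmoothAt (fun X : Entries n => paramFrame A (Matrix.of X)) X :=
  (((MatrixSmoothAt.const _).mul (matrixSmoothAt_matProj X)).mul (.const _)).mul (.const _)

theorem contDiffAt_paramInv (A : Matrix.symplecticGroup (Fin n) ℂ) {X : Entries n}
    (h : (paramFrame A (Matrix.of X)).toRows₁.det ≠ 0) :
    ContDiffAt ℝ ∞ (fun X : Entries n => paramInv A (Matrix.of X)) X := by
  have h1 : MatrixSmoothAt (fun X : Entries n => (paramFrame A (Matrix.of X)).toRows₁) X :=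
    fun i j => matrixSmoothAt_paramFrame A X (Sum.inl i) j
  have h2 : MatrixSmoothAt (fun X : Entries n => (paramFrame A (Matrix.of X)).toRows₂) X :=
    fun i j => matrixSmoothAt_paramFrame A X (Sum.inr i) j
  exact (LinearMap.toContinuousLinearMap (symmetrize n)).contDiff.contDiffAt.comp X
    (h2.mul (h1.inv h)).contDiffAt

/-- The set of matrices `Q Q^L` for the Lagrangian subspaces parametrized by `LGr.param A`. -/
def paramTarget (A : Matrix.symplecticGroup (Fin n) ℂ) : Set (Entries n) :=
  {X | (paramFrame A (Matrix.of X)).toRows₁.det ≠ 0}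

theorem isOpen_paramTarget (A : Matrix.symplecticGroup (Fin n) ℂ) : IsOpen (paramTarget A) := by
  refine isOpen_ne_fun (continuous_iff_continuousAt.2 fun X => ?_) continuous_const
  exact (MatrixSmoothAt.det (f := fun X : Entries n => (paramFrame A (Matrix.of X)).toRows₁)
    fun i j => matrixSmoothAt_paramFrame A X (Sum.inl i) j).continuousAt

/-- The embedding of the Lagrangian Grassmannian in the space of matrices. -/
def LGr.emb (L : LGr n) : Entries n := entries L.toMat

theorem contDiff_emb_param (A : Matrix.symplecticGroup (Fin n) ℂ) :
    ContDiff ℝ ∞ fun S : Sym n => (LGr.param A S).emb := by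
  rw [contDiff_iff_contDiffAt]
  intro S
  have h : MatrixSmoothAt (fun S : Sym n => graphFrame (Sym.toMatrix S)) S := by
    rintro (i | i) j
    · exact contDiffAt_const
    · exact contDiffAt_pi.1 (contDiffAt_pi.1 (Sym n).subtypeL.contDiff.contDiffAt i) j
  have h1 : MatrixSmoothAt (fun S => (A : BlockMat n) * graphFrame (Sym.toMatrix S)) S :=
    (MatrixSmoothAt.const _).mul h
  have h2 : MatrixSmoothAt (fun S => colProj ((A : BlockMat n) * graphFrame (Sym.toMatrix S))) S :=
    (h1.mul ((h1.conjTranspose.mul h1).inv (det_gram_graphFrame_ne_zero A _))).mul h1.conjTranspose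
  have h3 := (((h2.const_smul 2).sub (.const 1)).mul (.const (Inn n))).contDiffAt
  refine h3.congr_of_eventuallyEq (Filter.Eventually.of_forall fun S => ?_)
  change entries (((2 : ℂ) • (LGr.param A S).proj - 1) * Inn n) = _
  rw [LGr.proj_param]
  rfl

theorem LGr.continuous_param (A : Matrix.symplecticGroup (Fin n) ℂ) :
    Continuous (LGr.param (n := n) A) :=
  continuous_iff_coinduced_le.2 (le_iSup (fun A : Matrix.symplecticGroup (Fin n) ℂ =>
    TopologicalSpace.coinduced (LGr.param A) inferInstance) A)

theorem LGr.continuous_emb : Continuous (LGr.emb (n := n)) :=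
  continuous_iSup_dom.2 fun A => continuous_coinduced_dom.2 (contDiff_emb_param A).continuous

theorem LGr.exists_param (L : LGr n) :
    ∃ (A : Matrix.symplecticGroup (Fin n) ℂ) (S : Sym n), LGr.param A S = L := by
  obtain ⟨Q, h⟩ := L.exists_act_std
  exact ⟨toSymplectic Q, 0, h⟩

/-- Near each point the identity factors as `LGr.param A` after `paramInv A` after `LGr.emb`. The
first two are continuous there, so neighbourhoods in the final topology are pulled back from the
space of matrices. -/
theorem LGr.isEmbedding_emb : Topology.IsEmbedding (LGr.emb (n := n)) := by
  refine ⟨Topology.isInducing_iff_nhds.2 fun L => le_antisymm ?_ ?_, fun L L' h =>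
    LGr.toMat_injective h⟩
  · exact LGr.continuous_emb.continuousAt.le_comap
  · obtain ⟨A, S, rfl⟩ := L.exists_param
    have h0 : (LGr.param A S).emb ∈ paramTarget A := det_toRows_paramFrame_ne_zero A S
    have h1 : Filter.Tendsto (fun L : LGr n => LGr.param A (paramInv A L.toMat))
        (Filter.comap LGr.emb (nhds (LGr.param A S).emb)) (nhds (LGr.param A S)) := by
      have h2 := ((LGr.continuous_param A).continuousAt.comp
        (contDiffAt_paramInv A h0).continuousAt).tendsto.comp
        (Filter.tendsto_comap (f := LGr.emb (n := n)) (x := nhds (LGr.param A S).emb))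
      have h3 : LGr.param A (paramInv A (Matrix.of (LGr.param A S).emb)) = LGr.param A S :=
        congrArg (LGr.param A) (paramInv_toMat_param A S)
      rw [Function.comp_apply, h3] at h2
      exact h2
    have h4 : (fun L : LGr n => LGr.param A (paramInv A L.toMat)) =ᶠ[Filter.comap LGr.emb
        (nhds (LGr.param A S).emb)] id := by
      filter_upwards [Filter.preimage_mem_comap ((isOpen_paramTarget A).mem_nhds h0)] with L hL
      exact param_paramInv A L hL
    have h5 := h1.congr' h4
    exact h5

theorem LGr.range_emb : Set.range (LGr.emb (n := n)) = {X | Matrix.of X ∈ QQL n} := by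
  rw [← LGr.range_toMat]
  rfl

/-- The parametrizations are local diffeomorphisms for the smooth structure induced by the
embedding in the space of matrices. -/
theorem LGr.isLocalDiffeomorph_param {k : ℕ} [ChartedSpace (EuclideanSpace ℝ (Fin k)) (LGr n)]
    (h : Manifold.IsSmoothEmbedding (𝓡 k) 𝓘(ℝ, Entries n) ∞ (LGr.emb (n := n)))
    (A : Matrix.symplecticGroup (Fin n) ℂ) :
    IsLocalDiffeomorph 𝓘(ℝ, Sym n) (𝓡 k) ∞ (LGr.param A) := by
  let e : PartialDiffeomorph 𝓘(ℝ, Sym n) (𝓡 k) (Sym n) (LGr n) ∞ :=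
    { toFun := LGr.param A
      invFun := fun L => paramInv A L.toMat
      -- A single inverse serves all of `Sym n`: the parametrization is a diffeomorphism onto an
      -- open subset.
      source := Set.univ
      target := LGr.emb ⁻¹' paramTarget A
      map_source' := fun S _ => det_toRows_paramFrame_ne_zero A S
      map_target' := fun _ _ => Set.mem_univ _
      left_inv' := fun S _ => paramInv_toMat_param A S
      right_inv' := fun L hL => param_paramInv A L hL
      open_source := isOpen_univ
      open_target := (isOpen_paramTarget A).preimage LGr.continuous_emb
      contMDiffOn_toFun := ((ContMDiff.iff_comp_isImmersion h.isImmersion).2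
        ⟨LGr.continuous_param A, (contDiff_emb_param A).contMDiff⟩).contMDiffOn
      contMDiffOn_invFun := fun L hL =>
        ((contDiffAt_paramInv A hL).contMDiffAt.comp L
          h.isImmersion.contMDiff.contMDiffAt).contMDiffWithinAt }
  exact fun S => ⟨e, Set.mem_univ S, fun _ _ => rfl⟩

end ComplexLagrangian

end

/-! ### Slice charts for `Sp n` and `QQL n`, and the embedding of the quotient -/

noncomputable section

namespace ComplexLagrangian

variable {n : ℕ}

theorem det_one_add_one_ne_zero : (1 + 1 : BlockMat n).det ≠ 0 := by
  have h : (1 + 1 : BlockMat n) = (2 : ℂ) • 1 := (two_smul ℂ 1).symm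
  rw [h, Matrix.det_smul, Matrix.det_one, mul_one]
  exact pow_ne_zero _ two_ne_zero

/-- Left multiplication by a symplectic unitary matrix preserves `Sp(n)`. -/
theorem conjTranspose_mul_mem_Sp_iff {Q X : BlockMat n} (hQ : Q ∈ Sp n) :
    Qᴴ * X ∈ Sp n ↔ X ∈ Sp n := by
  refine ⟨fun h => ?_, fun h => mul_mem (conjTranspose_mem_Sp hQ) h⟩
  have h1 : Q * Qᴴ = 1 := Matrix.mem_unitaryGroup_iff.1 hQ.1
  have h2 := mul_mem hQ h
  rwa [← mul_assoc, h1, one_mul] at h2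

/-- The chart `Y ↦ cayley(Xᴴ Y)`: left translation moves `X` to `1`, where the Cayley transform is
defined because `1 + 1` is invertible. -/
theorem exists_sliceChart_Sp {X : Entries n} (hX : Matrix.of X ∈ Sp n) :
    ∃ c : SliceChart (spLie n) {X : Entries n | Matrix.of X ∈ Sp n}, X ∈ c.chart.source := by
  refine ⟨⟨cayleyChart (toUnits hX) 1, contDiffOn_cayleyChart _ _, contDiffOn_cayleyChart_symm _ _,
    fun Y hY => ?_⟩, ?_⟩
  · refine Iff.trans ?_ (cayley_mem_spLie_iff hY).symm
    change _ ↔ (Matrix.of X)ᴴ * Matrix.of Y * ((1⁻¹ : (BlockMat n)ˣ) : BlockMat n) ∈ Sp n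
    rw [inv_one, Units.val_one, mul_one, conjTranspose_mul_mem_Sp_iff hX]
    rfl
  · change (1 + (Matrix.of X)ᴴ * Matrix.of X * ((1⁻¹ : (BlockMat n)ˣ) : BlockMat n)).det ≠ 0
    have h : (Matrix.of X)ᴴ * Matrix.of X = 1 := Matrix.mem_unitaryGroup_iff'.1 hX.1
    rw [inv_one, Units.val_one, mul_one, h]
    exact det_one_add_one_ne_zero

theorem mul_mul_lagAdj_mem_QQL {A X : BlockMat n} (hA : A ∈ Sp n) (hX : X ∈ QQL n) :
    A * X * lagAdj A ∈ QQL n := by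
  obtain ⟨Q, hQ, rfl⟩ := hX
  exact ⟨A * Q, mul_mem hA hQ, by rw [lagAdj_mul]; simp only [mul_assoc]⟩

theorem lagAdj_conjTranspose (A : BlockMat n) : lagAdj Aᴴ = (lagAdj A)ᴴ := by
  simp only [lagAdj, Matrix.conjTranspose_mul, Inn_conjTranspose, Matrix.conjTranspose_conjTranspose,
    mul_assoc]

/-- For `X = A A^L` the action of `A⁻¹ = Aᴴ` preserves `QQL n` and moves `X` to `1`, so one Cayley
chart at `1` suffices. -/
theorem exists_sliceChart_QQL {X : Entries n} (hX : Matrix.of X ∈ QQL n) :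
    ∃ c : SliceChart (symLie n) {X : Entries n | Matrix.of X ∈ QQL n}, X ∈ c.chart.source := by
  obtain ⟨A, hA, h⟩ := hX
  have hA' := lagAdj_mem_Sp hA
  have h1 : A * Aᴴ = 1 := Matrix.mem_unitaryGroup_iff.1 hA.1
  have h2 : Aᴴ * A = 1 := Matrix.mem_unitaryGroup_iff'.1 hA.1
  have h1' : lagAdj A * (lagAdj A)ᴴ = 1 := Matrix.mem_unitaryGroup_iff.1 hA'.1
  have h2' : (lagAdj A)ᴴ * lagAdj A = 1 := Matrix.mem_unitaryGroup_iff'.1 hA'.1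
  refine ⟨⟨cayleyChart (toUnits hA) (toUnits hA'), contDiffOn_cayleyChart _ _,
    contDiffOn_cayleyChart_symm _ _, fun Y hY => ?_⟩, ?_⟩
  · refine Iff.trans ?_ (cayley_mem_symLie_iff hY).symm
    rw [← mem_QQL_iff]
    change Matrix.of Y ∈ QQL n ↔ Aᴴ * Matrix.of Y * (lagAdj A)ᴴ ∈ QQL n
    refine ⟨fun h3 => ?_, fun h3 => ?_⟩
    · rw [← lagAdj_conjTranspose]
      exact mul_mul_lagAdj_mem_QQL (conjTranspose_mem_Sp hA) h3
    · have h4 := mul_mul_lagAdj_mem_QQL hA h3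
      have h5 : A * (Aᴴ * Matrix.of Y * (lagAdj A)ᴴ) * lagAdj A = Matrix.of Y := by
        calc _ = (A * Aᴴ) * Matrix.of Y * ((lagAdj A)ᴴ * lagAdj A) := by simp only [mul_assoc]
          _ = _ := by rw [h1, h2', one_mul, mul_one]
      rwa [h5] at h4
  · change (1 + Aᴴ * Matrix.of X * (lagAdj A)ᴴ).det ≠ 0
    have h5 : Aᴴ * Matrix.of X * (lagAdj A)ᴴ = 1 := by
      rw [h]
      calc _ = (Aᴴ * A) * (lagAdj A * (lagAdj A)ᴴ) := by simp only [mul_assoc]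
        _ = _ := by rw [h2, h1', one_mul]
    rw [h5]
    exact det_one_add_one_ne_zero

theorem isEmbedding_entries_val {S : Set (BlockMat n)} :
    Topology.IsEmbedding fun X : S => entries (X : BlockMat n) :=
  Topology.IsEmbedding.subtypeVal

theorem range_entries_val {S : Set (BlockMat n)} :
    (Set.range fun X : S => entries (X : BlockMat n)) = {X | Matrix.of X ∈ S} := by
  ext X
  exact ⟨fun ⟨Y, hY⟩ => hY ▸ Y.2, fun h => ⟨⟨_, h⟩, rfl⟩⟩

/-- `Q Q^L = 1` means that `Q` commutes with `I_{n,n}`, that is, `Q = diag(a, d)`. Unitarity makes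
`a` unitary, and the symplectic relation `aᵀ d = 1` then forces `d = ā`. -/
theorem lagAdj_mul_self_eq_one_iff (Q : Sp n) :
    (Q : BlockMat n) * lagAdj (Q : BlockMat n) = 1 ↔ Q ∈ U n := by
  constructor
  · intro h
    obtain ⟨h1, h2⟩ := mem_Sp_iff.1 Q.2
    rw [mul_one] at h1
    have h3 : Inn n * (Q : BlockMat n) = (Q : BlockMat n) * Inn n := by
      calc _ = ((Q : BlockMat n) * lagAdj (Q : BlockMat n)) * (Inn n * (Q : BlockMat n)) := by
            rw [h, one_mul]
        _ = (Q : BlockMat n) * Inn n * ((Q : BlockMat n)ᴴ * ((Inn n * Inn n) *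
            (Q : BlockMat n))) := by simp only [lagAdj, mul_assoc]
        _ = _ := by rw [Inn_mul_Inn, one_mul, h1, mul_one]
    obtain ⟨a, b, c, d, hQ⟩ : ∃ a b c d, (Q : BlockMat n) = Matrix.fromBlocks a b c d :=
      ⟨_, _, _, _, (Matrix.fromBlocks_toBlocks _).symm⟩
    rw [hQ, Inn, Matrix.fromBlocks_multiply, Matrix.fromBlocks_multiply] at h3
    have h4 := Matrix.fromBlocks_inj.1 h3
    simp only [Matrix.one_mul, Matrix.zero_mul, Matrix.mul_zero, Matrix.mul_neg, Matrix.mul_one,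
      Matrix.neg_mul, add_zero, zero_add] at h4
    have hz : ∀ x : Matrix (Fin n) (Fin n) ℂ, x = -x → x = 0 := fun x hx => by
      ext i j
      exact self_eq_neg.1 (congrFun (congrFun hx i) j)
    have hb : b = 0 := hz b h4.2.1
    have hc : c = 0 := hz c h4.2.2.1.symm
    subst hb hc
    rw [hQ, Matrix.fromBlocks_conjTranspose, Matrix.fromBlocks_multiply, ← Matrix.fromBlocks_one]
      at h1
    have ha : aᴴ * a = 1 := by simpa using (Matrix.fromBlocks_inj.1 h1).1
    rw [hQ, Matrix.J, Matrix.fromBlocks_transpose, Matrix.fromBlocks_multiply,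
      Matrix.fromBlocks_multiply] at h2
    have had : aᵀ * d = 1 := by simpa using (Matrix.fromBlocks_inj.1 h2).2.1
    have hd : d = a.map star := by
      have h5 : a.map star * aᵀ = 1 := by
        have h6 := congrArg Matrix.transpose (mul_eq_one_comm.1 ha)
        rw [Matrix.transpose_mul, Matrix.transpose_one] at h6
        exact h6
      calc d = a.map star * aᵀ * d := by rw [h5, Matrix.one_mul]
        _ = _ := by rw [Matrix.mul_assoc, had, Matrix.mul_one]
    refine ⟨⟨a, Matrix.mem_unitaryGroup_iff'.2 ha⟩, Subtype.ext ?_⟩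
    rw [hQ, hd]
    rfl
  · rintro ⟨A, rfl⟩
    have h := Matrix.mem_unitaryGroup_iff.1 (unitaryEmbedding n A).2.1
    rw [Matrix.star_eq_conjTranspose] at h
    have hI : Inn n * ((unitaryEmbedding n A : Sp n) : BlockMat n)ᴴ * Inn n =
        ((unitaryEmbedding n A : Sp n) : BlockMat n)ᴴ := by
      change Inn n * (Matrix.fromBlocks _ _ _ _)ᴴ * Inn n = (Matrix.fromBlocks _ _ _ _)ᴴ
      simp [Inn, Matrix.fromBlocks_conjTranspose, Matrix.fromBlocks_multiply]
    rw [lagAdj, hI, h]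

theorem mul_lagAdj_eq_iff (Q R : Sp n) : (Q : BlockMat n) * lagAdj (Q : BlockMat n) =
    (R : BlockMat n) * lagAdj (R : BlockMat n) ↔ (QuotientGroup.mk Q : Sp n ⧸ U n) =
      QuotientGroup.mk R := by
  rw [QuotientGroup.eq, ← lagAdj_mul_self_eq_one_iff]
  have h1 : (Q : BlockMat n)ᴴ * (Q : BlockMat n) = 1 := Matrix.mem_unitaryGroup_iff'.1 Q.2.1
  have h2 : (Q : BlockMat n) * (Q : BlockMat n)ᴴ = 1 := Matrix.mem_unitaryGroup_iff.1 Q.2.1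
  have h3 : lagAdj (Q : BlockMat n) * lagAdj (Q : BlockMat n)ᴴ = 1 := by
    rw [← lagAdj_mul, h1, lagAdj_one]
  have h4 : lagAdj (Q : BlockMat n)ᴴ * lagAdj (Q : BlockMat n) = 1 := by
    rw [← lagAdj_mul, h2, lagAdj_one]
  have h5 : ((Q⁻¹ * R : Sp n) : BlockMat n) * lagAdj ((Q⁻¹ * R : Sp n) : BlockMat n) =
      (Q : BlockMat n)ᴴ * ((R : BlockMat n) * lagAdj (R : BlockMat n)) *
        lagAdj (Q : BlockMat n)ᴴ := by
    change ((Q : BlockMat n)ᴴ * (R : BlockMat n)) * lagAdj ((Q : BlockMat n)ᴴ * (R : BlockMat n)) = _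
    rw [lagAdj_mul]
    simp only [mul_assoc]
  rw [h5]
  constructor
  · intro h
    rw [← h, mul_assoc, mul_assoc, h3, mul_one, h1]
  · intro h
    calc _ = (Q : BlockMat n) * ((Q : BlockMat n)ᴴ * ((R : BlockMat n) * lagAdj (R : BlockMat n)) *
        lagAdj (Q : BlockMat n)ᴴ) * lagAdj (Q : BlockMat n) := by rw [h, mul_one]
      _ = ((Q : BlockMat n) * (Q : BlockMat n)ᴴ) * ((R : BlockMat n) * lagAdj (R : BlockMat n)) *
        (lagAdj (Q : BlockMat n)ᴴ * lagAdj (Q : BlockMat n)) := by simp only [mul_assoc]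
      _ = _ := by rw [h2, h4, one_mul, mul_one]

/-- The map `[Q] ↦ Q Q^L`, with values in the space of matrices. -/
def quotEmb (n : ℕ) (q : Sp n ⧸ U n) : Entries n :=
  Quotient.liftOn' q (fun Q => entries ((Q : BlockMat n) * lagAdj (Q : BlockMat n)))
    fun Q R h => (mul_lagAdj_eq_iff Q R).2 (Quotient.sound' h)

theorem contDiff_mul_lagAdj :
    ContDiff ℝ ∞ fun X : Entries n => entries (Matrix.of X * lagAdj (Matrix.of X)) := by
  rw [contDiff_iff_contDiffAt]
  intro X
  exact (MatrixSmoothAt.of_id.mul (((MatrixSmoothAt.const _).mul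
    MatrixSmoothAt.of_id.conjTranspose).mul (.const _))).contDiffAt

theorem isClosed_Sp : IsClosed {X : Entries n | Matrix.of X ∈ Sp n} := by
  simp only [mem_Sp_iff]
  have hc : Continuous fun X : Entries n => (Matrix.of X : BlockMat n) := continuous_id
  exact (isClosed_eq ((hc.matrix_conjTranspose.matrix_mul continuous_const).matrix_mul hc)
    continuous_const).inter (isClosed_eq
      ((hc.matrix_transpose.matrix_mul continuous_const).matrix_mul hc) continuous_const)

instance : CompactSpace (Sp n) := by
  have h : IsCompact {X : Entries n | Matrix.of X ∈ Sp n} := by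
    refine Metric.isCompact_of_isClosed_isBounded isClosed_Sp ?_
    refine isBounded_iff_forall_norm_le.2 ⟨1, fun X hX => ?_⟩
    refine (pi_norm_le_iff_of_nonneg zero_le_one).2 fun i =>
      (pi_norm_le_iff_of_nonneg zero_le_one).2 fun j => ?_
    exact entry_norm_bound_of_unitary hX.1 i j
  exact isCompact_iff_compactSpace.1 h

theorem continuous_quotEmb : Continuous (quotEmb n) :=
  Continuous.quotient_liftOn' (contDiff_mul_lagAdj.continuous.comp
    (isEmbedding_entries_val (S := (Sp n : Set (BlockMat n)))).continuous) _

/-- A continuous injection from a compact space to a Hausdorff space is an embedding; compactness of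
the quotient comes from `Sp n`. -/
theorem isEmbedding_quotEmb : Topology.IsEmbedding (quotEmb n) := by
  refine (continuous_quotEmb.isClosedEmbedding fun q r => ?_).isEmbedding
  induction q using QuotientGroup.induction_on
  induction r using QuotientGroup.induction_on
  exact fun h => (mul_lagAdj_eq_iff _ _).1 h

theorem range_quotEmb : Set.range (quotEmb n) = {X | Matrix.of X ∈ QQL n} := by
  ext X
  constructor
  · rintro ⟨q, rfl⟩
    induction q using QuotientGroup.induction_on with
    | H Q => exact ⟨Q, Q.2, rfl⟩
  · rintro ⟨Q, hQ, h⟩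
    exact ⟨QuotientGroup.mk ⟨Q, hQ⟩, h.symm⟩

end ComplexLagrangian

end

/-! ### The projection to the quotient is a submersion -/

noncomputable section

theorem hasDerivAt_matrix_mul {l m k : Type*} [Fintype m] {A : ℝ → Matrix l m ℂ}
    {B : ℝ → Matrix m k ℂ} {A' : Matrix l m ℂ} {B' : Matrix m k ℂ} {x : ℝ}
    (hA : ∀ i j, HasDerivAt (fun t => A t i j) (A' i j) x)
    (hB : ∀ i j, HasDerivAt (fun t => B t i j) (B' i j) x) (i : l) (j : k) :
    HasDerivAt (fun t => (A t * B t) i j) ((A' * B x + A x * B') i j) x := by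
  simp only [Matrix.add_apply, Matrix.mul_apply, ← Finset.sum_add_distrib]
  exact HasDerivAt.fun_sum fun a _ => (hA i a).mul (hB a j)

namespace ComplexLagrangian

variable {n : ℕ}

-- `(1 + Z)ᴴ(1 + Z) = 1 + Zᴴ Z` is positive definite. Hence the Cayley transform is defined on the
-- whole Lie algebra.
open scoped ComplexOrder in
theorem det_one_add_ne_zero_of_skew {m : Type*} [Fintype m] [DecidableEq m] {Z : Matrix m m ℂ}
    (h : Zᴴ = -Z) : (1 + Z).det ≠ 0 := by
  have h1 : (1 + Z)ᴴ * (1 + Z) = 1 + Zᴴ * Z := by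
    rw [Matrix.conjTranspose_add, h, Matrix.conjTranspose_one]
    noncomm_ring
  have h2 := (Matrix.PosDef.one.add_posSemidef
    (Matrix.posSemidef_conjTranspose_mul_self Z)).det_pos.ne'
  rw [← h1, Matrix.det_mul] at h2
  exact right_ne_zero_of_mul h2

theorem cayley_mem_Sp {Z : BlockMat n} (h : Matrix.of.symm Z ∈ spLie n) : cayley Z ∈ Sp n := by
  have h1 := det_one_add_ne_zero_of_skew (Z := Z) h.1
  rw [← cayley_mem_spLie_iff (det_one_add_cayley_ne_zero h1), cayley_cayley h1]
  exact h

/-- The map `Z ↦ Q cayley(Z)` from `symLie n` to `Sp(n)`. -/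
def symCurve (Q : Sp n) (Z : symLie n) : Sp n := Q * ⟨cayley (Matrix.of Z.1), cayley_mem_Sp Z.2.1⟩

theorem matrixSmoothAt_symCurve (Q : Sp n) (Z : symLie n) :
    MatrixSmoothAt (fun Z : symLie n => (symCurve Q Z : BlockMat n)) Z :=
  (MatrixSmoothAt.const _).mul (MatrixSmoothAt.cayley (MatrixSmoothAt.of_contDiffAt
    (symLie n).subtypeL.contDiff.contDiffAt) (det_one_add_ne_zero_of_skew Z.2.1.1))

theorem symCurve_zero (Q : Sp n) : symCurve Q 0 = Q := by
  refine Subtype.ext ?_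
  change (Q : BlockMat n) * cayley (0 : BlockMat n) = Q
  simp [cayley]

theorem contDiff_symCurve (Q : Sp n) :
    ContDiff ℝ ∞ fun Z : symLie n => entries (symCurve Q Z : BlockMat n) :=
  contDiff_iff_contDiffAt.2 fun Z => (matrixSmoothAt_symCurve Q Z).contDiffAt

/-- The identity `(1 + Z) cayley(Z)² (1 + Z) = (1 - Z)²`, for `cayley(Z)²` in terms of
`X = Q cayley(Z)² Q^L`. -/
theorem one_add_mul_symCurve (Q : Sp n) (Z : symLie n) :
    (1 + Matrix.of Z.1) * ((Q : BlockMat n)ᴴ *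
      ((symCurve Q Z : BlockMat n) * lagAdj (symCurve Q Z : BlockMat n)) *
        lagAdj (Q : BlockMat n)ᴴ) * (1 + Matrix.of Z.1) =
      (1 - Matrix.of Z.1) * (1 - Matrix.of Z.1) := by
  have hd : (1 + (Matrix.of Z.1 : BlockMat n)).det ≠ 0 := det_one_add_ne_zero_of_skew Z.2.1.1
  have h1 : (Q : BlockMat n)ᴴ * (Q : BlockMat n) = 1 := Matrix.mem_unitaryGroup_iff'.1 Q.2.1
  have h2 : lagAdj (Q : BlockMat n) * lagAdj (Q : BlockMat n)ᴴ = 1 := by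
    rw [← lagAdj_mul, h1, lagAdj_one]
  have h3 : lagAdj (cayley (Matrix.of Z.1 : BlockMat n)) = cayley (Matrix.of Z.1) := by
    rw [lagAdj_cayley hd]
    exact congrArg cayley Z.2.2.symm
  change (1 + Matrix.of Z.1) * ((Q : BlockMat n)ᴴ *
      (((Q : BlockMat n) * cayley (Matrix.of Z.1)) *
        lagAdj ((Q : BlockMat n) * cayley (Matrix.of Z.1))) * lagAdj (Q : BlockMat n)ᴴ) *
        (1 + Matrix.of Z.1) = _
  rw [lagAdj_mul, h3]
  calc _ = (1 + Matrix.of Z.1) * (((Q : BlockMat n)ᴴ * (Q : BlockMat n)) *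
        cayley (Matrix.of Z.1) * cayley (Matrix.of Z.1) *
        (lagAdj (Q : BlockMat n) * lagAdj (Q : BlockMat n)ᴴ)) * (1 + Matrix.of Z.1) := by
        simp only [mul_assoc]
    _ = ((1 + Matrix.of Z.1) * cayley (Matrix.of Z.1)) *
        (cayley (Matrix.of Z.1) * (1 + Matrix.of Z.1)) := by
        rw [h1, h2, one_mul, mul_one]
        simp only [mul_assoc]
    _ = _ := by rw [one_add_mul_cayley hd, cayley_mul_one_add hd]

/-- Along `t ↦ tZ` both sides of `one_add_mul_symCurve` are differentiated at `0`. If `Q cayley(tZ)²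
Q^L` has derivative zero, the left side contributes `2Z` and the right side `-2Z`, so `4Z = 0`. -/
theorem fderiv_quotEmb_symCurve_injective (Q : Sp n) : Function.Injective
    (fderiv ℝ (fun Z : symLie n => quotEmb n (QuotientGroup.mk (symCurve Q Z))) 0) := by
  rw [injective_iff_map_eq_zero]
  intro Z hZ
  have hF : ContDiff ℝ ∞ (fun Z : symLie n => quotEmb n (QuotientGroup.mk (symCurve Q Z))) :=
    contDiff_mul_lagAdj.comp (contDiff_symCurve Q)
  have h1 : HasDerivAt (fun t : ℝ => t • Z) Z 0 := by
    simpa using (hasDerivAt_id (0 : ℝ)).smul_const Z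
  have h2 : HasFDerivAt (fun Z : symLie n => quotEmb n (QuotientGroup.mk (symCurve Q Z)))
      (fderiv ℝ (fun Z : symLie n => quotEmb n (QuotientGroup.mk (symCurve Q Z))) 0)
      ((0 : ℝ) • Z) := by
    rw [zero_smul]
    exact (hF.differentiable (by simp)).differentiableAt.hasFDerivAt
  have h3 := h2.comp_hasDerivAt (0 : ℝ) h1
  rw [hZ] at h3
  have h4 : ∀ i j, HasDerivAt (fun t : ℝ => ((symCurve Q (t • Z) : BlockMat n) *
      lagAdj (symCurve Q (t • Z) : BlockMat n)) i j) ((0 : BlockMat n) i j) 0 :=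
    fun i j => hasDerivAt_pi.1 (hasDerivAt_pi.1 h3 i) j
  have h5 : ∀ i j, HasDerivAt (fun t : ℝ => (Matrix.of (t • Z).1 : BlockMat n) i j)
      ((Matrix.of Z.1 : BlockMat n) i j) 0 := fun i j => by
    have := (hasDerivAt_id (0 : ℝ)).smul_const (Z.1 i j)
    simpa using this
  have h6 : ∀ i j, HasDerivAt (fun t : ℝ => (1 + Matrix.of (t • Z).1 : BlockMat n) i j)
      ((Matrix.of Z.1 : BlockMat n) i j) 0 := fun i j => (h5 i j).const_add _
  have h7 : ∀ i j, HasDerivAt (fun t : ℝ => (1 - Matrix.of (t • Z).1 : BlockMat n) i j)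
      ((-Matrix.of Z.1 : BlockMat n) i j) 0 := fun i j => (h5 i j).const_sub _
  have hc : ∀ (A : BlockMat n) i j, HasDerivAt (fun _ : ℝ => A i j) ((0 : BlockMat n) i j) 0 :=
    fun A i j => hasDerivAt_const _ _
  have h8 := hasDerivAt_matrix_mul (hasDerivAt_matrix_mul h6 (hasDerivAt_matrix_mul
    (hasDerivAt_matrix_mul (hc (Q : BlockMat n)ᴴ) h4) (hc (lagAdj (Q : BlockMat n)ᴴ)))) h6
  have h9 := hasDerivAt_matrix_mul h7 h7
  simp only [one_add_mul_symCurve] at h8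
  have h10 : (Q : BlockMat n)ᴴ * ((symCurve Q ((0 : ℝ) • Z) : BlockMat n) *
      lagAdj (symCurve Q ((0 : ℝ) • Z) : BlockMat n)) * lagAdj (Q : BlockMat n)ᴴ = 1 := by
    have h := one_add_mul_symCurve Q ((0 : ℝ) • Z)
    have h0 : (Matrix.of ((0 : ℝ) • Z).1 : BlockMat n) = 0 := by
      rw [zero_smul]
      rfl
    rwa [h0, add_zero, sub_zero, one_mul, mul_one, mul_one] at h
  have h0 : (Matrix.of ((0 : ℝ) • Z).1 : BlockMat n) = 0 := by
    rw [zero_smul]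
    rfl
  rw [h10, h0] at h8
  rw [h0] at h9
  ext i j
  have h := (h8 i j).unique (h9 i j)
  simp at h
  change (Z.1 i j : ℂ) = 0
  linear_combination h / 4

/-- The projection is a submersion for the smooth structure induced by the embedding of the
quotient in the space of matrices. -/
theorem contMDiff_mk_and_surjective_mfderiv {k l : ℕ} (hl : l = n * (n + 1))
    [ChartedSpace (EuclideanSpace ℝ (Fin k)) (Sp n)]
    [ChartedSpace (EuclideanSpace ℝ (Fin l)) (Sp n ⧸ U n)]
    (h : Manifold.IsSmoothEmbedding (𝓡 k) 𝓘(ℝ, Entries n) ∞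
      fun Q : Sp n => entries (Q : BlockMat n))
    (h' : Manifold.IsSmoothEmbedding (𝓡 l) 𝓘(ℝ, Entries n) ∞ (quotEmb n)) :
    ContMDiff (𝓡 k) (𝓡 l) ∞ (QuotientGroup.mk : Sp n → Sp n ⧸ U n) ∧
      ∀ Q : Sp n, Function.Surjective
        (mfderiv (𝓡 k) (𝓡 l) (QuotientGroup.mk : Sp n → Sp n ⧸ U n) Q) := by
  have hmk : ContMDiff (𝓡 k) (𝓡 l) ∞ (QuotientGroup.mk : Sp n → Sp n ⧸ U n) :=
    (ContMDiff.iff_comp_isImmersion h'.isImmersion).2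
      ⟨continuous_quot_mk, contDiff_mul_lagAdj.contMDiff.comp h.isImmersion.contMDiff⟩
  refine ⟨hmk, fun Q => ?_⟩
  have hs : ContMDiff 𝓘(ℝ, symLie n) (𝓡 k) ∞ (symCurve Q) :=
    (ContMDiff.iff_comp_isImmersion h.isImmersion).2
      ⟨h.isEmbedding.continuous_iff.2 (contDiff_symCurve Q).continuous,
        (contDiff_symCurve Q).contMDiff⟩
  have hn : (∞ : WithTop ℕ∞) ≠ 0 := by simp
  have d1 := (hs.mdifferentiable hn) 0
  have d2 := (hmk.mdifferentiable hn) (symCurve Q 0)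
  have d3 := (h'.isImmersion.contMDiff.mdifferentiable hn) (QuotientGroup.mk (symCurve Q 0))
  have hcomp := mfderiv_comp (0 : symLie n) (I := 𝓘(ℝ, symLie n)) (I' := 𝓡 l)
    (g := quotEmb n) (f := (QuotientGroup.mk : Sp n → Sp n ⧸ U n) ∘ symCurve Q)
    d3 (d2.comp _ d1)
  -- The injective derivative factors through that of the projection composed with `symCurve Q`, so
  -- this composite `D` is injective too.
  rw [mfderiv_comp (0 : symLie n) d2 d1] at hcomp
  have hinj := fderiv_quotEmb_symCurve_injective Q
  rw [← mfderiv_eq_fderiv] at hinj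
  have hcomp' : (mfderiv 𝓘(ℝ, symLie n) 𝓘(ℝ, Entries n)
      (fun Z : symLie n => quotEmb n (QuotientGroup.mk (symCurve Q Z))) 0) = _ := hcomp
  rw [hcomp'] at hinj
  let D : symLie n →ₗ[ℝ] EuclideanSpace ℝ (Fin l) :=
    ((mfderiv (𝓡 k) (𝓡 l) (QuotientGroup.mk : Sp n → Sp n ⧸ U n) (symCurve Q 0)).comp
      (mfderiv 𝓘(ℝ, symLie n) (𝓡 k) (symCurve Q) 0)).toLinearMap
  have hD : Function.Injective D := fun x y hxy => hinj (congrArg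
    (mfderiv (𝓡 l) 𝓘(ℝ, Entries n) (quotEmb n) (QuotientGroup.mk (symCurve Q 0))) hxy)
  -- `symLie n` and the model space of the quotient both have dimension `n(n+1)`.
  have hD' : Function.Surjective D := (LinearMap.injective_iff_surjective_of_finrank_eq_finrank
    (by rw [finrank_symLie, finrank_euclideanSpace_fin, hl])).1 hD
  have hfin : Function.Surjective
      (mfderiv (𝓡 k) (𝓡 l) (QuotientGroup.mk : Sp n → Sp n ⧸ U n) (symCurve Q 0)) := fun w => by
    obtain ⟨z, hz⟩ := hD' w
    exact ⟨_, hz⟩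
  rwa [symCurve_zero] at hfin

end ComplexLagrangian

end

/-! ### Assembly of the theorem -/

open ComplexLagrangian in
theorem mainTheorem7 (n : ℕ) (hn : 0 < n) :
    (∃ (_ : ChartedSpace (EuclideanSpace ℝ (Fin (n * (2 * n + 1)))) (Sp n))
       (_ : ChartedSpace (EuclideanSpace ℝ (Fin (n * (n + 1)))) (LGr n))
       (_ : ChartedSpace (EuclideanSpace ℝ (Fin (n * (n + 1)))) (Sp n ⧸ U n))
       (_ : ChartedSpace (EuclideanSpace ℝ (Fin (n * (n + 1)))) (QQL n)),
      -- `Sp(n)` with its smooth structure as a submanifold of the space of matrices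
      (IsManifold (𝓡 (n * (2 * n + 1))) ∞ (Sp n) ∧
        Manifold.IsSmoothEmbedding (𝓡 (n * (2 * n + 1))) 𝓘(ℝ, Entries n) ∞
          (fun Q : Sp n => entries (Q : BlockMat n))) ∧
      -- `LGr(ℂ²ⁿ)` with the smooth structure given by its affine parametrizations
      (IsManifold (𝓡 (n * (n + 1))) ∞ (LGr n) ∧
        ∀ A : Matrix.symplecticGroup (Fin n) ℂ,
          IsLocalDiffeomorph 𝓘(ℝ, Sym n) (𝓡 (n * (n + 1))) ∞ (LGr.param A)) ∧
      -- `Sp(n)/U(n)` with the smooth structure for which the projection is a submersion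
      (IsManifold (𝓡 (n * (n + 1))) ∞ (Sp n ⧸ U n) ∧
        ContMDiff (𝓡 (n * (2 * n + 1))) (𝓡 (n * (n + 1))) ∞
          (QuotientGroup.mk : Sp n → Sp n ⧸ U n) ∧
        ∀ Q : Sp n, Function.Surjective
          (mfderiv (𝓡 (n * (2 * n + 1))) (𝓡 (n * (n + 1)))
            (QuotientGroup.mk : Sp n → Sp n ⧸ U n) Q)) ∧
      -- `{Q Q^L}` as a submanifold of the space of matrices
      (IsManifold (𝓡 (n * (n + 1))) ∞ (QQL n) ∧
        Manifold.IsSmoothEmbedding (𝓡 (n * (n + 1))) 𝓘(ℝ, Entries n) ∞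
          (fun X : QQL n => entries (X : BlockMat n))) ∧
      -- the two equivariant diffeomorphisms
      (∃ Φ : LGr n ≃ₘ^∞⟮𝓡 (n * (n + 1)), 𝓡 (n * (n + 1))⟯ (Sp n ⧸ U n),
        (∀ Q : Sp n, Φ (LGr.act (toSymplectic Q) (LGr.std n)) = QuotientGroup.mk Q) ∧
        ∀ (A : Sp n) (L : LGr n), Φ (LGr.act (toSymplectic A) L) = A • Φ L) ∧
      (∃ Ψ : (Sp n ⧸ U n) ≃ₘ^∞⟮𝓡 (n * (n + 1)), 𝓡 (n * (n + 1))⟯ (QQL n),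
        (∀ Q : Sp n, (Ψ (QuotientGroup.mk Q) : BlockMat n) = (Q : BlockMat n) * lagAdj (Q : BlockMat n)) ∧
        ∀ (A : Sp n) (q : Sp n ⧸ U n),
          (Ψ (A • q) : BlockMat n) = (A : BlockMat n) * (Ψ q : BlockMat n) * lagAdj (A : BlockMat n))) ∧
    QQL n = (Sp n : Set (BlockMat n)) ∩ (V2 n : Set (BlockMat n)) ∧
    (Sp n : Set (BlockMat n)) ∩ (V2 n : Set (BlockMat n)) = {X | X ∈ Sp n ∧ X = lagAdj X} := by
  refine ⟨?_, ?_, rfl⟩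
  · have hSp := range_entries_val (S := (Sp n : Set (BlockMat n)))
    obtain ⟨c₁, m₁, i₁⟩ := exists_smooth_structure_of_sliceCharts finrank_spLie
      (isEmbedding_entries_val (S := (Sp n : Set (BlockMat n)))) hSp
      fun _ hX => exists_sliceChart_Sp hX
    obtain ⟨c₂, m₂, i₂⟩ := exists_smooth_structure_of_sliceCharts finrank_symLie
      LGr.isEmbedding_emb LGr.range_emb fun _ hX => exists_sliceChart_QQL hX
    obtain ⟨c₃, m₃, i₃⟩ := exists_smooth_structure_of_sliceCharts finrank_symLie
      isEmbedding_quotEmb range_quotEmb fun _ hX => exists_sliceChart_QQL hX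
    obtain ⟨c₄, m₄, i₄⟩ := exists_smooth_structure_of_sliceCharts finrank_symLie
      (isEmbedding_entries_val (S := QQL n)) range_entries_val fun _ hX => exists_sliceChart_QQL hX
    refine ⟨c₁, c₂, c₃, c₄, ⟨m₁, i₁⟩, ⟨m₂, LGr.isLocalDiffeomorph_param i₂⟩,
      ⟨m₃, contMDiff_mk_and_surjective_mfderiv rfl i₁ i₃⟩, ⟨m₄, i₄⟩, ?_, ?_⟩
    · obtain ⟨Φ, hΦ⟩ := exists_diffeomorph_of_range_eq i₂ i₃
        (LGr.range_emb.trans range_quotEmb.symm)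
      have hQ : ∀ Q : Sp n, Φ (LGr.act (toSymplectic Q) (LGr.std n)) = QuotientGroup.mk Q :=
        -- Both sides have the same image `Q Q^L` in the space of matrices.
        fun Q => isEmbedding_quotEmb.injective ((hΦ _).trans (congrArg entries (LGr.toMat_act_std Q)))
      refine ⟨Φ, hQ, fun A L => ?_⟩
      -- By transitivity, equivariance need only be checked at `L = Q(ℂⁿ × {0})`.
      obtain ⟨Q, rfl⟩ := L.exists_act_std
      rw [LGr.act_act, hQ, hQ]
      rfl
    · obtain ⟨Ψ, hΨ⟩ := exists_diffeomorph_of_range_eq i₃ i₄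
        (range_quotEmb.trans range_entries_val.symm)
      have hQ : ∀ Q : Sp n, (Ψ (QuotientGroup.mk Q) : BlockMat n) =
          (Q : BlockMat n) * lagAdj (Q : BlockMat n) := fun Q => hΨ _
      refine ⟨Ψ, hQ, fun A q => ?_⟩
      induction q using QuotientGroup.induction_on with
      | H Q =>
        have h : A • (QuotientGroup.mk Q : Sp n ⧸ U n) = QuotientGroup.mk (A * Q) := rfl
        rw [h, hQ, hQ]
        change (A : BlockMat n) * (Q : BlockMat n) * lagAdj ((A : BlockMat n) * (Q : BlockMat n)) = _
        rw [lagAdj_mul]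
        simp only [mul_assoc]
  · ext X
    exact mem_QQL_iff
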